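/- Let $\tau$ be a family of subsets of the spaces $\mathbb{R}^n$, $n\in\mathbb{N}=\{0,1,2,\dots\}$, that is, $\tau\subseteq\bigsqcup_{n}\mathcal{P}(\mathbb{R}^n)$. Definitions. *Infinitary primitive positive formulas* over a signature form the smallest class that contains true, false and the atomic formulas (equations between terms, and relation symbols applied to terms) and is closed under substitution of variables, under finite and infinite conjunctions having altogether only finitely many free variables, and under existential quantification $\exists x$. The family $\tau$ is *closed under infinitary pp-definitions* over $(\mathbb{R};+,\cdot c\mid c\in\mathbb{R},c\mid c\in\mathbb{R})$ if every $S\subseteq\mathbb{R}^n$ that is defined by such a formula in the structure on $\mathbb{R}$ with addition, all multiplications by a real scalar, all real constants, and a relation symbol for every member of $\tau$, belongs to $\tau$. An *affine set* is the empty set or a translate of a linear subspace of $\mathbb{R}^n$. For a convex $S\subseteq\mathbb{R}^n$, a *semident* of $S$ is a point $a\notin S$ of the form $a=\lambda s+(1-\lambda)t$ with $s\in S$, $t\in\overline{S}$, $\lambda\in(0,1)$; and $S$ *has a ray intersection* if there are $v,w\in\mathbb{R}^n$ with $v+xw\in S$ for all $x>0$ and $v+xw\notin S$ for all $x<0$.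 A map $f\colon\mathbb{R}^{\mathbb{N}}\to\mathbb{R}$ *preserves* $S\subseteq\mathbb{R}^n$ if for every sequence $(x^i)_{i\in\mathbb{N}}$ in $S$ the point $\bigl(f((x^i_1)_{i}),\dots,f((x^i_n)_{i})\bigr)$ is in $S$. Theorem. Assume that every member of $\tau$ is convex. Then the following are equivalent: 1. $\tau$ is closed under infinitary pp-definitions over $(\mathbb{R};+,\cdot c\mid c\in\mathbb{R},c\mid c\in\mathbb{R})$. 2. $\tau$ contains the empty set (as a subset of each $\mathbb{R}^n$) and $\mathbb{R}^1$; for every affine map $f\colon\mathbb{R}^n\to\mathbb{R}^m$, it contains $f(S)$ for each $S\subseteq\mathbb{R}^n$ in $\tau$ and $f^{-1}(T)$ for each $T\subseteq\mathbb{R}^m$ in $\tau$; and for every $n$ and every $I\subseteq\tau\cap\mathcal{P}(\mathbb{R}^n)$ it contains $\bigcap_{S\in I}S\subseteq\mathbb{R}^n$ (which is $\mathbb{R}^n$ for $I=\emptyset$). 3. $\tau$ is one of the following six families: (a) all affine sets; (b) all sums $B+V=\{b+v\mid b\in B,v\in V\}$ of a compact convex set $B\subseteq\mathbb{R}^n$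 and a linear subspace $V\subseteq\mathbb{R}^n$; (c) all sums $B+V$ of a bounded convex set $B$ and a linear subspace $V$ such that $B+V$ has no semident; (d) all sums $B+V$ of a bounded convex set $B$ and a linear subspace $V$; (e) all convex sets without a ray intersection; (f) all convex sets. 4. There is a set $F$ of linear maps $f\colon\mathbb{R}^{\mathbb{N}}\to\mathbb{R}$ with $f((c)_{n\in\mathbb{N}})=c$ for all $c\in\mathbb{R}$ such that $\tau$ is the family of all convex sets that are preserved by every $f\in F$. Moreover, the equivalence of (1) and (2) holds for every family $\tau\subseteq\bigsqcup_n\mathcal{P}(\mathbb{R}^n)$, without the assumption of convexity. -/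

import Mathlib

open scoped Pointwise

/-! ### Infinitary primitive positive formulas -/

/-- Infinitary primitive positive formulas over the first-order language `L`, with free variables
among `x₀, …, xₙ₋₁`: truth and falsity, atomic formulas (equations between terms, and relation
symbols applied to terms), substitution of variables, arbitrary conjunctions of formulas in the
same finitely many variables, and existential quantification over the last variable.

Every formula built by these rules has finitely many free variables, so working with finite
contexts is no restriction. -/
inductive InfPPFormula (L : FirstOrder.Language.{0, 0}) : ℕ → Type 1
  | verum {n : ℕ} : InfPPFormula L n
  | falsum {n : ℕ} : InfPPFormula L n
  | equal {n : ℕ} (t₁ t₂ : L.Term (Fin n)) : InfPPFormula L n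
  | rel {n m : ℕ} (R : L.Relations m) (t : Fin m → L.Term (Fin n)) : InfPPFormula L n
  | subst {n m : ℕ} (φ : InfPPFormula L n) (g : Fin n → Fin m) : InfPPFormula L m
  | conj {n : ℕ} {ι : Type} (φ : ι → InfPPFormula L n) : InfPPFormula L n
  | ex {n : ℕ} (φ : InfPPFormula L (n + 1)) : InfPPFormula L n

/-- Satisfaction of an infinitary primitive positive formula in an `L`-structure `A` under an
assignment of its free variables. -/
def InfPPFormula.Realize {L : FirstOrder.Language.{0, 0}} {A : Type} [L.Structure A] :
    {n : ℕ} → InfPPFormula L n → (Fin n → A) → Prop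
  | _, .verum, _ => True
  | _, .falsum, _ => False
  | _, .equal t₁ t₂, v => t₁.realize v = t₂.realize v
  | _, .rel R t, v => FirstOrder.Language.Structure.RelMap R (fun i => (t i).realize v)
  | _, .subst φ g, v => φ.Realize (fun i => v (g i))
  | _, .conj φ, v => ∀ i, (φ i).Realize v
  | _, .ex φ, v => ∃ a : A, φ.Realize (Fin.snoc v a)

/-- `S ⊆ Aⁿ` is infinitary primitively positively definable in the `L`-structure `A`. -/
def InfPPDefinable (L : FirstOrder.Language.{0, 0}) {A : Type} [L.Structure A] {n : ℕ}
    (S : Set (Fin n → A)) : Prop :=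
  ∃ φ : InfPPFormula L n, S = {v | φ.Realize v}

/-! ### Families of real relations and the structure they generate -/

/-- A family `τ ⊆ ⨆ₙ 𝒫(ℝⁿ)` of subsets of the spaces `ℝⁿ`; `τ n` is the set of its members that
are subsets of `ℝⁿ`. -/
abbrev RealFamily : Type := (n : ℕ) → Set (Set (Fin n → ℝ))

/-- The function symbols of `(ℝ; +, ·c | c ∈ ℝ, c | c ∈ ℝ)`. -/
inductive AffineFunctionSymbol : ℕ → Type
  | const (c : ℝ) : AffineFunctionSymbol 0
  | smul (c : ℝ) : AffineFunctionSymbol 1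
  | add : AffineFunctionSymbol 2

/-- The signature of `(ℝ; +, ·c | c ∈ ℝ, c | c ∈ ℝ)` together with one relation symbol for every
member of `τ`. -/
def affineLanguage (τ : RealFamily) : FirstOrder.Language.{0, 0} where
  Functions := AffineFunctionSymbol
  Relations n := {S : Set (Fin n → ℝ) // S ∈ τ n}

/-- The structure `(ℝ; +, ·c | c ∈ ℝ, c | c ∈ ℝ, S | S ∈ τ)`. -/
instance affineStructure (τ : RealFamily) : (affineLanguage τ).Structure ℝ where
  funMap {_} f :=
    match f with
    | AffineFunctionSymbol.const c => fun _ => c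
    | AffineFunctionSymbol.smul c => fun x => c * x 0
    | AffineFunctionSymbol.add => fun x => x 0 + x 1
  RelMap {_} R x := x ∈ R.1

/-- `τ` is closed under infinitary pp-definitions over `(ℝ; +, ·c | c ∈ ℝ, c | c ∈ ℝ)`: every
relation with an infinitary pp-definition from this structure and members of `τ` is in `τ`. -/
def ClosedUnderInfPP (τ : RealFamily) : Prop :=
  ∀ (n : ℕ) (S : Set (Fin n → ℝ)), InfPPDefinable (affineLanguage τ) S → S ∈ τ n

/-- `τ` contains the empty set and `ℝ¹`, and is closed under images and preimages of affine maps
and under arbitrary intersections (the empty intersection in `ℝⁿ` being `ℝⁿ`). -/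
structure GeometricallyClosed (τ : RealFamily) : Prop where
  empty_mem : ∀ n : ℕ, (∅ : Set (Fin n → ℝ)) ∈ τ n
  line_mem : (Set.univ : Set (Fin 1 → ℝ)) ∈ τ 1
  image_mem : ∀ (n m : ℕ) (f : (Fin n → ℝ) →ᵃ[ℝ] (Fin m → ℝ)) (S : Set (Fin n → ℝ)),
    S ∈ τ n → f '' S ∈ τ m
  preimage_mem : ∀ (n m : ℕ) (f : (Fin n → ℝ) →ᵃ[ℝ] (Fin m → ℝ)) (T : Set (Fin m → ℝ)),
    T ∈ τ m → f ⁻¹' T ∈ τ n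
  sInter_mem : ∀ (n : ℕ) (I : Set (Set (Fin n → ℝ))), I ⊆ τ n → ⋂₀ I ∈ τ n

/-! ### The six families -/

/-- `a` is a semident of `S`: `a ∉ S`, but `a` lies in the open segment between a point of `S` and
a point of the closure of `S`. -/
def IsSemident {n : ℕ} (S : Set (Fin n → ℝ)) (a : Fin n → ℝ) : Prop :=
  a ∉ S ∧ ∃ s ∈ S, ∃ t ∈ closure S, ∃ l ∈ Set.Ioo (0 : ℝ) 1, a = l • s + (1 - l) • t

/-- `S` has a ray intersection: some affine map `x ↦ v + x w` sends all `x > 0` into `S` and all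
`x < 0` outside `S`. -/
def HasRayIntersection {n : ℕ} (S : Set (Fin n → ℝ)) : Prop :=
  ∃ v w : Fin n → ℝ, (∀ x : ℝ, 0 < x → v + x • w ∈ S) ∧ (∀ x : ℝ, x < 0 → v + x • w ∉ S)

/-- All affine sets, the empty set included. -/
def affineFamily : RealFamily := fun n =>
  {S | ∃ A : AffineSubspace ℝ (Fin n → ℝ), S = (A : Set (Fin n → ℝ))}

/-- All sums of a compact convex set and a vector space. -/
def compactFamily : RealFamily := fun n =>
  {S | ∃ (B : Set (Fin n → ℝ)) (V : Submodule ℝ (Fin n → ℝ)),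
    IsCompact B ∧ Convex ℝ B ∧ S = B + (V : Set (Fin n → ℝ))}

/-- All sums of a bounded convex set and a vector space. -/
def boundedFamily : RealFamily := fun n =>
  {S | ∃ (B : Set (Fin n → ℝ)) (V : Submodule ℝ (Fin n → ℝ)),
    Bornology.IsBounded B ∧ Convex ℝ B ∧ S = B + (V : Set (Fin n → ℝ))}

/-- All sums of a bounded convex set and a vector space that have no semident. -/
def semidentFreeFamily : RealFamily := fun n =>
  {S | S ∈ boundedFamily n ∧ ∀ a, ¬ IsSemident S a}

/-- All convex sets without a ray intersection. -/
def rayFreeFamily : RealFamily := fun n =>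
  {S : Set (Fin n → ℝ) | Convex ℝ S ∧ ¬ HasRayIntersection S}

/-- All convex sets. -/
def convexFamily : RealFamily := fun n => {S : Set (Fin n → ℝ) | Convex ℝ S}

/-- `τ` is one of the six families. -/
def IsOneOfSix (τ : RealFamily) : Prop :=
  τ = affineFamily ∨ τ = compactFamily ∨ τ = semidentFreeFamily ∨ τ = boundedFamily ∨
    τ = rayFreeFamily ∨ τ = convexFamily

/-! ### Preservation by linear maps of countable arity -/

/-- `f : ℝ^ℕ → ℝ` preserves `S ⊆ ℝⁿ`: applied coordinatewise to a sequence of points of `S`, it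
yields a point of `S`. -/
def Preserves (f : (ℕ → ℝ) →ₗ[ℝ] ℝ) {n : ℕ} (S : Set (Fin n → ℝ)) : Prop :=
  ∀ x : ℕ → Fin n → ℝ, (∀ i, x i ∈ S) → (fun j => f (fun i => x i j)) ∈ S

/-- `τ` consists of exactly the convex sets that are preserved by all members of some set of linear
maps `ℝ^ℕ → ℝ` that send each constant sequence to its value. -/
def IsFamilyPreservedByLinearMaps (τ : RealFamily) : Prop :=
  ∃ F : Set ((ℕ → ℝ) →ₗ[ℝ] ℝ), (∀ f ∈ F, ∀ c : ℝ, f (fun _ => c) = c) ∧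
    ∀ (n : ℕ) (S : Set (Fin n → ℝ)), S ∈ τ n ↔ Convex ℝ S ∧ ∀ f ∈ F, Preserves f S

/-! The equivalence of (1) and (2) is an induction on formulas in one direction and explicit
formulas in the other. The classification rests on the chain affine ⊂ compact ⊂ semident-free ⊂
bounded ⊂ ray-free ⊂ convex. Each family after the first has a small generator: `[0,1]`, `(0,1)`,
`boxWedge`, `stripWedge`, `halfPlaneWedge`. Two facts are shown for a closed family of convex sets.
A member outside one family of the chain produces the generator of the next, by restricting to lines
or planes and intersecting affine copies (`mem_Icc_of_not_affine`, `mem_Ioo_of_not_compact`,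
`mem_boxWedge_of_semident`, `mem_stripWedge_of_not_bounded`, `mem_halfPlaneWedge_of_not_rayFree`).
Conversely, a generator, together with the earlier ones where needed, produces its whole family.

The converse uses hulls: `τ.hull x` is the least member containing all points `x i`, and a set is a
member as soon as the hull of its points stays inside. Closure under images means that a hull point
lifts along any additional coordinates (`exists_prod_mem_hull`), so it behaves like the value of a
generalized mean of the `x i`. If such a mean `a` were outside `S`, a functional `p` would weakly
separate it from `S`. The generator forces the indices with `p (x i) ≠ p a` to carry no weight, so
the problem moves into a hyperplane and induction on dimension applies
(`hull_subset_of_indicator_eq_zero`). In the semident-free case these indices may carry weight, but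
their mean lies in the closure of `S`, and the absence of semidents finishes the argument
(`inv_smul_mem_of_semidentFree`).

For (4), normalized linear maps commute with affine maps, so preserved families are closed. Each of
the first five families is cut out by one functional that preserves its generators and violates the
next one; all convex sets are obtained from no functional. -/

/-! ### Membership in a family for subsets of finite-dimensional spaces -/

section Membership

variable {E F : Type} [AddCommGroup E] [Module ℝ E] [AddCommGroup F] [Module ℝ F] {τ : RealFamily}

/-- A subset of a real vector space belongs to `τ` if all its preimages under affine maps from the
spaces `ℝⁿ` do. -/
def RealFamily.Mem (τ : RealFamily) (T : Set E) : Prop :=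
  ∀ (n : ℕ) (g : (Fin n → ℝ) →ᵃ[ℝ] E), g ⁻¹' T ∈ τ n

theorem RealFamily.Mem.mem {n : ℕ} {T : Set (Fin n → ℝ)} (hT : τ.Mem T) : T ∈ τ n :=
  hT n (AffineMap.id ℝ _)

theorem RealFamily.Mem.preimage {T : Set E} (hT : τ.Mem T) (A : F →ᵃ[ℝ] E) : τ.Mem (A ⁻¹' T) :=
  fun n g => hT n (A.comp g)

theorem RealFamily.Mem.convex (hc : ∀ (n : ℕ) (S : Set (Fin n → ℝ)), S ∈ τ n → Convex ℝ S)
    {T : Set E} (hT : τ.Mem T) : Convex ℝ T := by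
  intro x hx y hy a b ha hb hab
  have h := hc 1 _ (hT 1 ((AffineMap.lineMap x y : ℝ →ᵃ[ℝ] E).comp
    (LinearMap.proj (0 : Fin 1) : (Fin 1 → ℝ) →ₗ[ℝ] ℝ).toAffineMap))
  have h0 : (fun _ => 0 : Fin 1 → ℝ) ∈ ((AffineMap.lineMap x y : ℝ →ᵃ[ℝ] E).comp
    (LinearMap.proj (0 : Fin 1) : (Fin 1 → ℝ) →ₗ[ℝ] ℝ).toAffineMap) ⁻¹' T := by simpa using hx
  have h1 : (fun _ => 1 : Fin 1 → ℝ) ∈ ((AffineMap.lineMap x y : ℝ →ᵃ[ℝ] E).comp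
    (LinearMap.proj (0 : Fin 1) : (Fin 1 → ℝ) →ₗ[ℝ] ℝ).toAffineMap) ⁻¹' T := by simpa using hy
  have h2 := h h0 h1 ha hb hab
  have e : a • x + b • y = AffineMap.lineMap x y b := by
    rw [AffineMap.lineMap_apply_module, ← hab]; simp
  rw [e]
  simpa using h2

namespace GeometricallyClosed

variable (h : GeometricallyClosed τ)
include h

theorem mem_of_mem {n : ℕ} {T : Set (Fin n → ℝ)} (hT : T ∈ τ n) : τ.Mem T :=
  fun m g => h.preimage_mem m n g T hT

theorem mem_iInter {ι : Sort*} {T : ι → Set E} (hT : ∀ i, τ.Mem (T i)) : τ.Mem (⋂ i, T i) := by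
  intro n g
  rw [Set.preimage_iInter, ← Set.sInter_range]
  apply h.sInter_mem
  rintro _ ⟨i, rfl⟩
  exact hT i n g

theorem mem_inter {S T : Set E} (hS : τ.Mem S) (hT : τ.Mem T) : τ.Mem (S ∩ T) := by
  rw [Set.inter_eq_iInter]
  exact h.mem_iInter (by rintro (_ | _) <;> assumption)

theorem mem_univ : τ.Mem (Set.univ : Set E) := by
  intro n g
  simpa using h.sInter_mem n ∅ (by simp)

theorem mem_empty : τ.Mem (∅ : Set E) := fun n _ => h.empty_mem n

/-- Closure under arbitrary intersections in pointwise form: it suffices to exclude each outside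
point separately. Most constructions of members below use it. -/
theorem mem_of_forall_notMem {T : Set E}
    (hT : ∀ a ∉ T, ∃ T' : Set E, τ.Mem T' ∧ T ⊆ T' ∧ a ∉ T') : τ.Mem T := by
  choose! U hU hTU haU using hT
  have : T = ⋂ a : {a // a ∉ T}, U a := by
    ext x
    simp only [Set.mem_iInter, Subtype.forall]
    refine ⟨fun hx a ha => hTU a ha hx, fun hx => ?_⟩
    by_contra hxT
    exact haU x hxT (hx x hxT)
  rw [this]
  exact h.mem_iInter fun a => hU a a.2

theorem mem_image [FiniteDimensional ℝ E] [FiniteDimensional ℝ F] {T : Set E} (hT : τ.Mem T)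
    (A : E →ᵃ[ℝ] F) : τ.Mem (A '' T) := by
  intro n g
  let φ := (Module.finBasis ℝ E).equivFun
  let ψ := (Module.finBasis ℝ F).equivFun
  have h1 := h.image_mem _ _ ((ψ.toLinearMap.toAffineMap.comp A).comp φ.symm.toLinearMap.toAffineMap)
    _ (hT _ φ.symm.toLinearMap.toAffineMap)
  have h2 := h.preimage_mem _ _ (ψ.toLinearMap.toAffineMap.comp g) _ h1
  convert h2 using 1
  ext v
  simp only [Set.mem_preimage, Set.mem_image, AffineMap.coe_comp, Function.comp,
    LinearMap.coe_toAffineMap, LinearEquiv.coe_coe]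
  constructor
  · rintro ⟨x, hx, hxv⟩
    exact ⟨φ x, by simpa using hx, by simp [hxv]⟩
  · rintro ⟨x, hx, hxv⟩
    exact ⟨φ.symm x, hx, ψ.injective hxv⟩

theorem mem_singleton [FiniteDimensional ℝ E] (a : E) : τ.Mem ({a} : Set E) := by
  have := h.mem_image (h.mem_univ (E := E)) (AffineMap.const ℝ E a)
  convert this using 1
  ext x
  simp [eq_comm]

end GeometricallyClosed

/-- The smallest member of `τ` that contains all points `x i`. -/
def RealFamily.hull (τ : RealFamily) {I : Type*} (x : I → E) : Set E :=
  {a | ∀ T : Set E, τ.Mem T → (∀ i, x i ∈ T) → a ∈ T}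

variable {I : Type*}

theorem RealFamily.map_mem_hull {x : I → E} {a : E} (ha : a ∈ τ.hull x) (A : E →ᵃ[ℝ] F) :
    A a ∈ τ.hull (fun i => A (x i)) :=
  fun _ hT hx => ha _ (hT.preimage A) hx

namespace GeometricallyClosed

variable (h : GeometricallyClosed τ)
include h

theorem mem_hull (x : I → E) : τ.Mem (τ.hull x) := by
  refine h.mem_of_forall_notMem fun a ha => ?_
  simp only [RealFamily.hull, Set.mem_ofPred_eq, not_forall] at ha
  obtain ⟨T, hT, hx, haT⟩ := ha
  exact ⟨T, hT, fun b hb => hb T hT hx, haT⟩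

/-- The image of the hull of `x` is a member containing every `A (x i)`, hence it contains their
hull. Applied to a projection, this is the lifting property of hull points. -/
theorem exists_mem_hull_of_map [FiniteDimensional ℝ E] [FiniteDimensional ℝ F] {x : I → E}
    (A : E →ᵃ[ℝ] F) {b : F} (hb : b ∈ τ.hull (fun i => A (x i))) : ∃ a ∈ τ.hull x, A a = b :=
  hb _ (h.mem_image (h.mem_hull x) A) fun i => ⟨x i, fun _ _ hx => hx i, rfl⟩

/-- A point of a hull lifts along any family of additional coordinates. -/
theorem exists_prod_mem_hull [FiniteDimensional ℝ E] [FiniteDimensional ℝ F] {x : I → E} {a : E}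
    (ha : a ∈ τ.hull x) (y : I → F) : ∃ b : F, (a, b) ∈ τ.hull (fun i => (x i, y i)) := by
  obtain ⟨⟨a', b⟩, hab, rfl⟩ :=
    h.exists_mem_hull_of_map (x := fun i => (x i, y i)) (LinearMap.fst ℝ E F).toAffineMap ha
  exact ⟨b, hab⟩

theorem nonempty_of_mem_hull {x : I → E} {a : E} (ha : a ∈ τ.hull x) : Nonempty I := by
  by_contra hI
  exact ha ∅ h.mem_empty fun i => (hI ⟨i⟩).elim

theorem mem_of_forall_hull {S : Set E} (hS : ∀ a ∈ τ.hull (Subtype.val : S → E), a ∈ S) :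
    τ.Mem S := by
  have : S = τ.hull (Subtype.val : S → E) :=
    Set.Subset.antisymm (fun a ha T _ hx => hx ⟨a, ha⟩) hS
  rw [this]
  exact h.mem_hull _

end GeometricallyClosed

end Membership

/-! ### Infinitary primitive positive definability and geometric closure -/

section Definability

variable {τ : RealFamily}

theorem affineLanguage.exists_affineMap_realize {n : ℕ} (t : (affineLanguage τ).Term (Fin n)) :
    ∃ A : (Fin n → ℝ) →ᵃ[ℝ] ℝ, ∀ v, t.realize v = A v := by
  induction t with
  | var i => exact ⟨(LinearMap.proj i).toAffineMap, fun v => rfl⟩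
  | func f ts ih =>
    choose A hA using ih
    cases f with
    | const c => exact ⟨AffineMap.const ℝ _ c, fun v => rfl⟩
    | smul c =>
      refine ⟨c • A 0, fun v => ?_⟩
      change c * (ts 0).realize v = _
      simp [hA]
    | add =>
      refine ⟨A 0 + A 1, fun v => ?_⟩
      change (ts 0).realize v + (ts 1).realize v = _
      simp [hA]

theorem affineLanguage.exists_affineMap_realize_pi {n m : ℕ}
    (t : Fin m → (affineLanguage τ).Term (Fin n)) :
    ∃ A : (Fin n → ℝ) →ᵃ[ℝ] (Fin m → ℝ), ∀ v, (fun i => (t i).realize v) = A v := by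
  choose A hA using fun i => affineLanguage.exists_affineMap_realize (t i)
  exact ⟨AffineMap.pi A, fun v => by ext i; simp [hA]⟩

theorem GeometricallyClosed.realize_mem (h : GeometricallyClosed τ) {n : ℕ}
    (φ : InfPPFormula (affineLanguage τ) n) : τ.Mem {v : Fin n → ℝ | φ.Realize v} := by
  induction φ with
  | verum => simpa [InfPPFormula.Realize] using h.mem_univ
  | falsum => simpa [InfPPFormula.Realize] using h.mem_empty
  | equal t₁ t₂ =>
    obtain ⟨A₁, h₁⟩ := affineLanguage.exists_affineMap_realize t₁
    obtain ⟨A₂, h₂⟩ := affineLanguage.exists_affineMap_realize t₂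
    convert (h.mem_singleton (0 : ℝ)).preimage (A₁ - A₂) using 1
    ext v
    simp [InfPPFormula.Realize, h₁, h₂, sub_eq_zero]
  | rel R t =>
    obtain ⟨A, hA⟩ := affineLanguage.exists_affineMap_realize_pi t
    convert (h.mem_of_mem R.2).preimage A using 1
    ext v
    simp only [InfPPFormula.Realize, hA]
    rfl
  | subst φ g ih =>
    exact ih.preimage (LinearMap.funLeft ℝ ℝ g).toAffineMap
  | conj φ ih =>
    convert h.mem_iInter ih using 1
    ext v
    simp [InfPPFormula.Realize]
  | ex φ ih =>
    convert h.mem_image ih (LinearMap.funLeft ℝ ℝ Fin.castSucc).toAffineMap using 1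
    ext v
    simp only [InfPPFormula.Realize, Set.mem_ofPred_eq, Set.mem_image, LinearMap.coe_toAffineMap]
    constructor
    · rintro ⟨a, ha⟩
      exact ⟨_, ha, by ext i; simp [LinearMap.funLeft]⟩
    · rintro ⟨w, hw, rfl⟩
      refine ⟨w (Fin.last _), ?_⟩
      convert hw
      ext i
      refine Fin.lastCases ?_ (fun i => ?_) i <;> simp [LinearMap.funLeft]

theorem AffineMap.apply_eq_add_sum {n : ℕ} (A : (Fin n → ℝ) →ᵃ[ℝ] ℝ) (v : Fin n → ℝ) :
    A v = A 0 + ∑ i, v i * A.linear (Pi.single i 1) := by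
  have h1 := A.linearMap_vsub v 0
  simp only [vsub_eq_sub, sub_zero] at h1
  rw [LinearMap.pi_apply_eq_sum_univ] at h1
  simp only [smul_eq_mul] at h1
  have h2 : ∀ i : Fin n, (Pi.single i (1 : ℝ) : Fin n → ℝ) = fun j => if i = j then 1 else 0 := by
    intro i; ext j; simp [Pi.single_apply, eq_comm]
  simp only [h2, h1]; ring

theorem affineLanguage.exists_term {n : ℕ} (A : (Fin n → ℝ) →ᵃ[ℝ] ℝ) :
    ∃ t : (affineLanguage τ).Term (Fin n), ∀ v : Fin n → ℝ, t.realize v = A v := by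
  have key : ∀ s : Finset (Fin n), ∃ t : (affineLanguage τ).Term (Fin n), ∀ v : Fin n → ℝ,
      t.realize v = A 0 + ∑ i ∈ s, v i * A.linear (Pi.single i 1) := by
    intro s
    induction s using Finset.induction_on with
    | empty =>
      exact ⟨.func (AffineFunctionSymbol.const (A 0) : (affineLanguage τ).Functions 0) Fin.elim0,
        fun v => by simp only [Finset.sum_empty, add_zero]; rfl⟩
    | insert i s hi ih =>
      obtain ⟨t, ht⟩ := ih
      refine ⟨.func (AffineFunctionSymbol.add : (affineLanguage τ).Functions 2)
        ![t, .func (AffineFunctionSymbol.smul (A.linear (Pi.single i 1)) :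
          (affineLanguage τ).Functions 1) ![.var i]], fun v => ?_⟩
      rw [Finset.sum_insert hi]
      change t.realize v + A.linear (Pi.single i 1) * v i = _
      rw [ht]; ring
  obtain ⟨t, ht⟩ := key Finset.univ
  refine ⟨t, fun v => ?_⟩
  rw [ht, ← A.apply_eq_add_sum]

/-- Iterated existential quantification over the last `m` variables. -/
theorem InfPPFormula.exists_realize_iff {L : FirstOrder.Language.{0, 0}} {A : Type} [L.Structure A]
    {n : ℕ} : ∀ (m : ℕ) (φ : InfPPFormula L (n + m)), ∃ ψ : InfPPFormula L n, ∀ v : Fin n → A,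
      ψ.Realize v ↔ ∃ w : Fin m → A, φ.Realize (Fin.append v w)
  | 0, φ => ⟨φ, fun v => by
      have : ∀ w : Fin 0 → A, Fin.append v w = v := fun w => by
        rw [Subsingleton.elim w Fin.elim0, Fin.append_elim0]; rfl
      simp [this]⟩
  | m + 1, φ => by
    obtain ⟨ψ, hψ⟩ := exists_realize_iff (A := A) m (InfPPFormula.ex (n := n + m) φ)
    refine ⟨ψ, fun v => (hψ v).trans ?_⟩
    constructor
    · rintro ⟨w, a, hw⟩
      exact ⟨Fin.snoc w a, by rwa [Fin.append_snoc]⟩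
    · rintro ⟨w, hw⟩
      refine ⟨(Fin.init w : Fin m → A), (w (Fin.last m) : A), ?_⟩
      have e := Fin.append_snoc v (Fin.init w : Fin m → A) (w (Fin.last m))
      rw [Fin.snoc_init_self] at e
      rwa [← e]

theorem closedUnderInfPP_iff : ClosedUnderInfPP τ ↔ GeometricallyClosed τ := by
  refine ⟨fun h => ?_, fun h n S hS => ?_⟩
  · refine ⟨fun n => ?_, ?_, fun n m f S hS => ?_, fun n m f T hT => ?_, fun n I hI => ?_⟩
    · exact h n _ ⟨.falsum, by simp [InfPPFormula.Realize]⟩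
    · exact h 1 _ ⟨.verum, by simp [InfPPFormula.Realize]⟩
    · choose t ht using fun j => affineLanguage.exists_term (τ := τ)
        ((LinearMap.proj j : (Fin m → ℝ) →ₗ[ℝ] ℝ).toAffineMap.comp f)
      -- The image is `∃ w, w ∈ S ∧ v = f w`: the first `m` variables are `v` and the last `n` are
      -- `w`. The index `none` carries `w ∈ S`, and `some j` the `j`-th equation.
      obtain ⟨ψ, hψ⟩ := InfPPFormula.exists_realize_iff (L := affineLanguage τ) (A := ℝ) n
        (.conj (n := m + n) (ι := Option (Fin m)) fun o => o.elim
          (.rel (⟨S, hS⟩ : (affineLanguage τ).Relations n) fun i => .var (Fin.natAdd m i))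
          fun j => .equal (.var (Fin.castAdd n j)) ((t j).relabel (Fin.natAdd m)))
      refine h m _ ⟨ψ, ?_⟩
      ext v
      rw [Set.mem_ofPred_eq, hψ]
      refine exists_congr fun w => ?_
      simp only [InfPPFormula.Realize, Option.forall]
      simp only [Option.elim, InfPPFormula.Realize, FirstOrder.Language.Term.realize_var,
        Fin.append_right, Fin.append_left, FirstOrder.Language.Term.realize_relabel]
      refine and_congr Iff.rfl ?_
      have : ∀ j, (t j).realize (Fin.append v w ∘ Fin.natAdd m) = f w j := by
        intro j
        rw [show (Fin.append v w ∘ Fin.natAdd m) = w by ext i; simp, ht]; rfl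
      simp only [this]
      rw [funext_iff]
      exact forall_congr' fun j => eq_comm
    · choose t ht using fun j => affineLanguage.exists_term (τ := τ)
        ((LinearMap.proj j : (Fin m → ℝ) →ₗ[ℝ] ℝ).toAffineMap.comp f)
      refine h n _ ⟨.rel (⟨T, hT⟩ : (affineLanguage τ).Relations m) t, ?_⟩
      ext v
      simp only [InfPPFormula.Realize, ht]
      rfl
    · refine h n _ ⟨.conj fun S : I =>
        .rel (⟨S.1, hI S.2⟩ : (affineLanguage τ).Relations n) fun i => .var i, ?_⟩
      ext v
      simp only [InfPPFormula.Realize, Set.mem_sInter, Subtype.forall, Set.mem_ofPred_eq]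
      rfl
  · obtain ⟨φ, rfl⟩ := hS
    exact (h.realize_mem φ).mem

end Definability

/-! ### Convex sets in finite-dimensional spaces -/

section ConvexGeometry

open Set Filter Topology

variable {E : Type} [NormedAddCommGroup E] [NormedSpace ℝ E]

/-- `S` contains, with every open ray, a point of the line through it before the start of the
ray. -/
def RayFree (S : Set E) : Prop :=
  ∀ v w : E, (∀ x : ℝ, 0 < x → v + x • w ∈ S) → ∃ x : ℝ, x < 0 ∧ v + x • w ∈ S

/-- No point outside `S` is a proper convex combination of a point of `S` and a point of its
closure. -/
def SemidentFree (S : Set E) : Prop :=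
  ∀ s ∈ S, ∀ t ∈ closure S, ∀ l ∈ Ioo (0 : ℝ) 1, l • s + (1 - l) • t ∈ S

theorem not_hasRayIntersection_iff {n : ℕ} {S : Set (Fin n → ℝ)} :
    ¬ HasRayIntersection S ↔ RayFree S := by
  simp only [HasRayIntersection, RayFree, not_exists, not_and, not_forall, not_not, exists_prop]

theorem forall_not_isSemident_iff {n : ℕ} {S : Set (Fin n → ℝ)} :
    (∀ a, ¬ IsSemident S a) ↔ SemidentFree S := by
  constructor
  · intro h s hs t ht l hl
    by_contra hn
    exact h _ ⟨hn, s, hs, t, ht, l, hl, rfl⟩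
  · rintro h a ⟨ha, s, hs, t, ht, l, hl, rfl⟩
    exact ha (h s hs t ht l hl)

/-- A functional that is bounded below on a sum of a bounded set and a subspace vanishes on the
subspace. -/
theorem Submodule.eq_zero_of_forall_le {s : E} {V : Submodule ℝ E} {p : E →ₗ[ℝ] ℝ} {c : ℝ}
    (h : ∀ v ∈ V, c ≤ p (s + v)) {v : E} (hv : v ∈ V) : p v = 0 := by
  by_contra h0
  have := h ((-(p s - c + 1) / p v) • v) (V.smul_mem _ hv)
  rw [map_add, map_smul, smul_eq_mul, div_mul_cancel₀ _ h0] at this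
  linarith

variable [FiniteDimensional ℝ E]

/-- Any relative interior point serves as `r`. Inside the direction of its affine span the set has
full dimension, so it has an interior point there, and a segment from an interior point to a point
of the closure remains interior except possibly at its far end. -/
theorem Convex.exists_combo_mem_of_mem_closure {S : Set E} (hS : Convex ℝ S) (hne : S.Nonempty) :
    ∃ r ∈ S, ∀ t ∈ closure S, ∀ x : ℝ, 0 < x → x ≤ 1 → x • r + (1 - x) • t ∈ S := by
  have hne' := hne.coe_sort
  obtain ⟨p, hp⟩ := hne
  let p' : affineSpan ℝ S := ⟨p, subset_affineSpan _ _ hp⟩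
  let e := (AffineIsometryEquiv.constVSub ℝ p').symm
  let f : (affineSpan ℝ S).direction →ᵃ[ℝ] E :=
    (affineSpan ℝ S).subtype.comp e.toAffineEquiv.toAffineMap
  have hf : IsInducing f := IsInducing.subtypeVal.comp e.toHomeomorph.isInducing
  have hrange : range f = affineSpan ℝ S := by
    ext x
    constructor
    · rintro ⟨m, rfl⟩
      exact (e m).2
    · intro hx
      exact ⟨e.symm ⟨x, hx⟩, by simp [f]⟩
  have hconv : Convex ℝ (f ⁻¹' S) := hS.affine_preimage f
  have hint : (interior (f ⁻¹' S)).Nonempty := by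
    rw [hconv.interior_nonempty_iff_affineSpan_eq_top]
    have : f ⁻¹' S = e.toAffineEquiv ⁻¹' ((↑) ⁻¹' S : Set (affineSpan ℝ S)) := rfl
    rw [this, ← AffineSubspace.comap_span, affineSpan_coe_preimage_eq_top,
      AffineSubspace.comap_top]
  obtain ⟨r, hr⟩ := hint
  refine ⟨f r, (interior_subset hr : r ∈ f ⁻¹' S), fun t ht x hx0 hx1 => ?_⟩
  have himg : f '' (f ⁻¹' S) = S := by
    rw [image_preimage_eq_iff, hrange]
    exact subset_affineSpan ℝ S
  have htr : t ∈ range f := by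
    rw [hrange]
    exact closure_minimal (subset_affineSpan ℝ S)
      (AffineSubspace.closed_of_finiteDimensional _) ht
  obtain ⟨m, rfl⟩ := htr
  have hm : m ∈ closure (f ⁻¹' S) := by
    rw [hf.closure_eq_preimage_closure_image, himg]
    exact ht
  have := interior_subset (hconv.combo_interior_closure_mem_interior hr hm hx0
    (sub_nonneg.2 hx1) (by ring))
  rw [mem_preimage, Convex.combo_affine_apply (by ring)] at this
  exact this

/-- A point outside a nonempty convex set is weakly separated from it by a nonzero functional. -/
theorem Convex.exists_ne_zero_forall_le {S : Set E} (hS : Convex ℝ S) (hne : S.Nonempty) {b : E}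
    (hb : b ∉ S) : ∃ p : E →L[ℝ] ℝ, p ≠ 0 ∧ ∀ s ∈ S, p b ≤ p s := by
  by_cases hint : (interior S).Nonempty
  · obtain ⟨f, hf⟩ := geometric_hahn_banach_open_point hS.interior isOpen_interior
      (fun h => hb (interior_subset h))
    obtain ⟨u, hu⟩ := hint
    refine ⟨-f, fun h0 => ?_, fun s hs => ?_⟩
    · have := hf u hu
      simp [neg_eq_zero.1 h0] at this
    · have hs' : s ∈ closure (interior S) := by
        rw [hS.closure_interior_eq_closure_of_nonempty_interior ⟨u, hu⟩]
        exact subset_closure hs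
      have : closure (interior S) ⊆ {x | f x ≤ f b} :=
        closure_minimal (fun x hx => (hf x hx).le) (isClosed_le f.continuous continuous_const)
      simpa using this hs'
  -- Without interior, `S` spans a proper affine subspace; a functional constant on it separates
  -- weakly after a choice of sign.
  · rw [hS.interior_nonempty_iff_affineSpan_eq_top] at hint
    obtain ⟨s₀, hs₀⟩ := hne
    have hdir : (affineSpan ℝ S).direction < ⊤ := by
      rw [lt_top_iff_ne_top]
      intro h
      exact hint ((AffineSubspace.direction_eq_top_iff_of_nonempty
        ⟨s₀, subset_affineSpan _ _ hs₀⟩).1 h)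
    obtain ⟨f, hf0, hf⟩ := Submodule.exists_le_ker_of_lt_top _ hdir
    have hconst : ∀ s ∈ S, f s = f s₀ := by
      intro s hs
      have := hf (AffineSubspace.vsub_mem_direction (subset_affineSpan ℝ S hs)
        (subset_affineSpan ℝ S hs₀))
      simpa [sub_eq_zero] using this
    have hf0' : f.toContinuousLinearMap ≠ 0 := by
      intro h
      apply hf0
      ext x
      exact DFunLike.congr_fun h x
    rcases le_total (f b) (f s₀) with h | h
    · exact ⟨f.toContinuousLinearMap, hf0', fun s hs => by simpa [hconst s hs] using h⟩
    · exact ⟨-f.toContinuousLinearMap, neg_ne_zero.2 hf0', fun s hs => by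
        simpa [hconst s hs] using h⟩

/-- A closed convex set whose recession directions are all reversible is the sum of a compact
convex set and a subspace. -/
theorem Convex.exists_isCompact_add_submodule {C : Set E} (hC : Convex ℝ C) (hcl : IsClosed C)
    (hrec : ∀ w : E, (∀ s ∈ C, ∀ t : ℝ, 0 ≤ t → s + t • w ∈ C) →
      ∀ s ∈ C, ∀ t : ℝ, s + t • w ∈ C) :
    ∃ (K : Set E) (V : Submodule ℝ E), IsCompact K ∧ Convex ℝ K ∧ C = K + (V : Set E) := by
  -- The lineality space of `C`. The compact part is the slice of `C` by a complement.
  let V : Submodule ℝ E :=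
    { carrier := {w | ∀ s ∈ C, ∀ t : ℝ, s + t • w ∈ C}
      add_mem' := fun {a b} ha hb s hs t => by
        rw [smul_add, ← add_assoc]
        exact hb _ (ha s hs t) t
      zero_mem' := fun s hs t => by simpa using hs
      smul_mem' := fun c a ha s hs t => by
        rw [smul_smul]
        exact ha s hs _ }
  obtain ⟨M, hM⟩ := V.exists_isCompl
  have hMcl : IsClosed (M : Set E) := M.closed_of_finiteDimensional
  refine ⟨C ∩ M, V, ?_, hC.inter M.convex, ?_⟩
  · refine Metric.isCompact_of_isClosed_isBounded (hcl.inter hMcl) ?_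
    by_contra hb
    simp only [isBounded_iff_forall_norm_le, not_exists, not_forall, not_le, exists_prop] at hb
    -- In an unbounded slice the normalized points accumulate at a unit recession direction in `M`.
    -- It is reversible, hence in `V`, contradicting `V ⊓ M = ⊥`.
    choose x hx hxn using fun k : ℕ => hb (k + 1)
    have hpos : ∀ k, 0 < ‖x k‖ := fun k => lt_trans (by positivity) (hxn k)
    have hd : ∀ k, ‖x k‖⁻¹ • x k ∈ Metric.sphere (0 : E) 1 ∩ M := fun k => by
      refine ⟨?_, M.smul_mem _ (hx k).2⟩
      simp [norm_smul, (hpos k).ne']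
    obtain ⟨w, hw, φ, hφ, hlim⟩ :=
      ((isCompact_sphere (0 : E) 1).inter_right hMcl).tendsto_subseq hd
    have hinv : Tendsto (fun k => ‖x (φ k)‖⁻¹) atTop (𝓝 0) := by
      refine tendsto_inv_atTop_zero.comp (tendsto_atTop_mono (fun k => ?_)
        tendsto_natCast_atTop_atTop)
      have h1 : (k : ℝ) ≤ φ k := by exact_mod_cast hφ.id_le k
      linarith [hxn (φ k)]
    have hrecw : ∀ s ∈ C, ∀ t : ℝ, 0 ≤ t → s + t • w ∈ C := by
      intro s hs t ht
      have h1 : Tendsto (fun k => (1 - t * ‖x (φ k)‖⁻¹) • s + t • (‖x (φ k)‖⁻¹ • x (φ k)))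
          atTop (𝓝 ((1 - t * 0) • s + t • w)) :=
        ((tendsto_const_nhds.sub (hinv.const_mul t)).smul_const s).add (hlim.const_smul t)
      simp only [mul_zero, sub_zero, one_smul] at h1
      refine hcl.mem_of_tendsto h1 ?_
      have h2 : ∀ᶠ k in atTop, t * ‖x (φ k)‖⁻¹ < 1 := by
        have := hinv.const_mul t
        rw [mul_zero] at this
        exact this.eventually_lt_const one_pos
      filter_upwards [h2] with k hk
      rw [smul_smul]
      exact hC hs (hx (φ k)).1 (by linarith)
        (mul_nonneg ht (inv_nonneg.2 (norm_nonneg _))) (by ring)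
    have hwV : w ∈ V := hrec w hrecw
    have hw0 : w = 0 := by simpa [hM.inf_eq_bot] using (Submodule.mem_inf.2 ⟨hwV, hw.2⟩)
    simp [hw0] at hw
  · ext c
    constructor
    · intro hc
      obtain ⟨v, hv, m, hm, rfl⟩ : ∃ v ∈ V, ∃ m ∈ M, v + m = c := by
        rw [← Submodule.mem_sup, hM.sup_eq_top]; trivial
      refine ⟨m, ⟨?_, hm⟩, v, hv, add_comm _ _⟩
      have := hv _ hc (-1)
      simpa [add_comm] using this
    · rintro ⟨m, hm, v, hv, rfl⟩
      simpa using hv m hm.1 1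

/-- The closure of a convex set without ray intersection is the sum of a compact convex set and a
subspace, and some point is moved inside the set by that subspace. -/
theorem RayFree.exists_closure_eq {S : Set E} (hr : RayFree S) (hS : Convex ℝ S)
    (hne : S.Nonempty) :
    ∃ (K : Set E) (V : Submodule ℝ E), IsCompact K ∧ Convex ℝ K ∧ closure S = K + (V : Set E) ∧
      ∃ r : E, ∀ v ∈ V, r + v ∈ S := by
  obtain ⟨r, hrS, hcore⟩ := hS.exists_combo_mem_of_mem_closure hne
  have hhalf : ∀ u : E, r + (2 : ℝ) • u ∈ closure S → r + u ∈ S := by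
    intro u hu
    have := hcore _ hu (1 / 2) (by norm_num) (by norm_num)
    convert this using 1
    module
  obtain ⟨K, V, hK, hKc, hKV⟩ := hS.closure.exists_isCompact_add_submodule isClosed_closure (by
    intro w hw
    have hpos : ∀ t : ℝ, 0 ≤ t → r + t • w ∈ S := fun t ht =>
      hhalf _ (by rw [smul_smul]; exact hw r (subset_closure hrS) _ (by positivity))
    -- If the line through `r` left `S`, the infimum of its parameters in `S` would be the start of
    -- a ray intersection.
    have hall : ∀ t : ℝ, r + t • w ∈ S := by
      by_contra hcon
      push Not at hcon
      obtain ⟨m, hm⟩ := hcon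
      have hJ : Convex ℝ {t : ℝ | r + t • w ∈ S} := by
        intro x hx y hy a b ha hb hab
        have h1 := hS hx hy ha hb hab
        have h2 : a • (r + x • w) + b • (r + y • w) = (a + b) • r + (a • x + b • y) • w := by
          simp only [smul_eq_mul]
          module
        rw [h2, hab, one_smul] at h1
        exact h1
      set J : Set ℝ := {t : ℝ | r + t • w ∈ S}
      have hbdd : ∀ t ∈ J, m ≤ t := by
        intro t ht
        by_contra hlt
        have hm0 : m < 0 := by
          by_contra h0
          exact hm (hpos m (not_lt.1 h0))
        exact hm (hJ.ordConnected.out ht (hpos 0 le_rfl) ⟨(not_le.1 hlt).le, hm0.le⟩)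
      have hJne : J.Nonempty := ⟨0, hpos 0 le_rfl⟩
      obtain ⟨x, hx, hxS⟩ := hr (r + sInf J • w) w (fun x hx => by
        obtain ⟨y, hy, hyx⟩ := exists_lt_of_csInf_lt hJne (show sInf J < sInf J + x by linarith)
        have : sInf J + x ∈ J :=
          hJ.ordConnected.out hy (hpos (max 0 (sInf J + x)) (le_max_left _ _))
            ⟨hyx.le, le_max_right _ _⟩
        have h2 : r + (sInf J + x) • w ∈ S := this
        rwa [add_smul, ← add_assoc] at h2)
      have hxJ : sInf J + x ∈ J := by
        change r + (sInf J + x) • w ∈ S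
        rwa [add_smul, ← add_assoc]
      linarith [csInf_le ⟨m, hbdd⟩ hxJ]
    intro s hs t
    -- The line through `s` is approached by putting weight `1/(k+1)` on a point that is `k+1` times
    -- as far out on the line through `r`.
    have h1 : Tendsto (fun k : ℕ => (1 - 1 / ((k : ℝ) + 1)) • s +
        (1 / ((k : ℝ) + 1)) • (r + (((k : ℝ) + 1) * t) • w)) atTop
        (𝓝 (((1 : ℝ) - 0) • s + (0 : ℝ) • r + t • w)) := by
      have h0 := tendsto_one_div_add_atTop_nhds_zero_nat (𝕜 := ℝ)
      have := (((tendsto_const_nhds (x := (1 : ℝ))).sub h0).smul_const s).add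
        (h0.smul_const r) |>.add_const (t • w)
      refine this.congr fun k => ?_
      have hk : (k : ℝ) + 1 ≠ 0 := by positivity
      rw [smul_add, smul_smul, ← add_assoc]
      congr 2
      field_simp
    simp only [sub_zero, one_smul, zero_smul, add_zero] at h1
    refine isClosed_closure.mem_of_tendsto h1 (Eventually.of_forall fun k => ?_)
    have hk : 1 / ((k : ℝ) + 1) ≤ 1 := by
      rw [div_le_one (by positivity)]
      linarith [(Nat.cast_nonneg k : (0 : ℝ) ≤ k)]
    exact hS.closure hs (subset_closure (hall _)) (by linarith) (by positivity) (by ring))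
  refine ⟨K, V, hK, hKc, hKV, r, fun v hv => hhalf _ ?_⟩
  have hrc : r ∈ K + (V : Set E) := hKV ▸ subset_closure hrS
  obtain ⟨k, hk, u, hu, hku⟩ := hrc
  rw [hKV]
  refine ⟨k, hk, u + (2 : ℝ) • v, V.add_mem hu (V.smul_mem _ hv), ?_⟩
  rw [← hku]
  exact (add_assoc _ _ _).symm

/-- A functional bounded below on a translate of `V` inside `S` vanishes on `V`, so on `S` its
values are among those on the compact part `K`. -/
theorem RayFree.exists_forall_le {S : Set E} (hr : RayFree S) (hS : Convex ℝ S)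
    (p : E →L[ℝ] ℝ) {c : ℝ} (hp : ∀ s ∈ S, c ≤ p s) : ∃ M : ℝ, ∀ s ∈ S, p s ≤ M := by
  rcases S.eq_empty_or_nonempty with rfl | hne
  · exact ⟨0, by simp⟩
  obtain ⟨K, V, hK, -, hKV, r, hrV⟩ := hr.exists_closure_eq hS hne
  obtain ⟨M, hM⟩ := (hK.image p.continuous).bddAbove
  refine ⟨M, fun s hs => ?_⟩
  obtain ⟨k, hk, v, hv, rfl⟩ : s ∈ K + (V : Set E) := hKV ▸ subset_closure hs
  have hv0 : p v = 0 := Submodule.eq_zero_of_forall_le (p := (p : E →ₗ[ℝ] ℝ))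
    (fun v hv => hp _ (hrV v hv)) hv
  rw [map_add, hv0, add_zero]
  exact hM ⟨k, hk, rfl⟩

end ConvexGeometry

/-! ### Sets on lines and planes that generate the families -/

/-- The unit square without three sides, with one vertex put back. -/
def boxWedge : Set (ℝ × ℝ) := {p | (0 < p.1 ∧ p.1 ≤ 1 ∧ 0 ≤ p.2 ∧ p.2 ≤ 1) ∨ p = 0}

/-- A half-open strip together with one point of the missing line. -/
def stripWedge : Set (ℝ × ℝ) := {p | (0 < p.1 ∧ p.1 ≤ 1) ∨ p = 0}

/-- An open half-plane together with one boundary point. -/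
def halfPlaneWedge : Set (ℝ × ℝ) := {p | 0 < p.1 ∨ p = 0}

theorem boxWedge_eq_inter : boxWedge = stripWedge ∩ {p | p.2 ∈ Set.Icc (0 : ℝ) 1} := by
  ext ⟨x, y⟩
  simp only [stripWedge, boxWedge, Set.mem_ofPred_eq, Set.mem_inter_iff, Prod.mk_eq_zero,
    Set.mem_Icc]
  constructor
  · rintro (h1 | ⟨rfl, rfl⟩)
    · exact ⟨Or.inl ⟨h1.1, h1.2.1⟩, h1.2.2⟩
    · simp
  · rintro ⟨h1 | h1, h2⟩
    · exact Or.inl ⟨h1.1, h1.2, h2⟩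
    · exact Or.inr h1

theorem mem_stripWedge_iff {p : ℝ × ℝ} :
    p ∈ stripWedge ↔ 0 ≤ p.1 ∧ p.1 ≤ 1 ∧ (p.1 = 0 → p.2 = 0) := by
  constructor
  · rintro (⟨h0, h1⟩ | rfl)
    · exact ⟨h0.le, h1, fun h => absurd h h0.ne'⟩
    · simp
  · rintro ⟨h0, h1, h2⟩
    rcases h0.lt_or_eq with h0 | h0
    · exact Or.inl ⟨h0, h1⟩
    · exact Or.inr (Prod.ext h0.symm (h2 h0.symm))

theorem convex_stripWedge : Convex ℝ stripWedge := by
  intro x hx y hy a b ha hb hab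
  rw [mem_stripWedge_iff] at hx hy ⊢
  obtain ⟨hx0, hx1, hx2⟩ := hx
  obtain ⟨hy0, hy1, hy2⟩ := hy
  simp only [Prod.fst_add, Prod.smul_fst, smul_eq_mul, Prod.snd_add, Prod.smul_snd]
  refine ⟨by positivity, by nlinarith, fun h => ?_⟩
  rw [add_eq_zero_iff_of_nonneg (by positivity) (by positivity), mul_eq_zero, mul_eq_zero] at h
  have hax : a * x.2 = 0 := h.1.elim (fun h => by simp [h]) fun h => by simp [hx2 h]
  have hby : b * y.2 = 0 := h.2.elim (fun h => by simp [h]) fun h => by simp [hy2 h]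
  rw [hax, hby, add_zero]

theorem convex_boxWedge : Convex ℝ boxWedge := by
  rw [boxWedge_eq_inter]
  exact convex_stripWedge.inter ((convex_Icc (0 : ℝ) 1).linear_preimage (LinearMap.snd ℝ ℝ ℝ))

section Generators

open Set

variable {E : Type} [AddCommGroup E] [Module ℝ E] {τ : RealFamily}

theorem RealFamily.Mem.preimage_functional {T : Set ℝ} (hT : τ.Mem T) (L : E →ₗ[ℝ] ℝ) (c : ℝ) :
    τ.Mem {x : E | L x + c ∈ T} :=
  hT.preimage (L.toAffineMap + AffineMap.const ℝ E c)

theorem RealFamily.Mem.preimage_line {T : Set E} (hT : τ.Mem T) (v a : E) :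
    τ.Mem {t : ℝ | v + t • a ∈ T} := by
  convert hT.preimage ((LinearMap.id.smulRight a : ℝ →ₗ[ℝ] E).toAffineMap + AffineMap.const ℝ ℝ v)
    using 1
  ext t
  simp [add_comm]

theorem RealFamily.Mem.preimage_plane {T : Set E} (hT : τ.Mem T) (v a b : E) :
    τ.Mem {p : ℝ × ℝ | v + p.1 • a + p.2 • b ∈ T} := by
  convert hT.preimage (((LinearMap.fst ℝ ℝ ℝ).smulRight a +
    (LinearMap.snd ℝ ℝ ℝ).smulRight b).toAffineMap + AffineMap.const ℝ (ℝ × ℝ) v) using 1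
  ext p
  simp [add_comm, add_assoc]

namespace GeometricallyClosed

variable (h : GeometricallyClosed τ)
include h

theorem affineFamily_subset (n : ℕ) : affineFamily n ⊆ τ n := by
  rintro _ ⟨A, rfl⟩
  rcases (A : Set (Fin n → ℝ)).eq_empty_or_nonempty with he | ⟨p, hp⟩
  · rw [he]
    exact h.empty_mem n
  · refine RealFamily.Mem.mem ?_
    convert h.mem_image (h.mem_univ (E := A.direction))
      (A.direction.subtype.toAffineMap + AffineMap.const ℝ _ p) using 1
    ext x
    simp only [SetLike.mem_coe, image_univ, mem_range, AffineMap.coe_add, Pi.add_apply,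
      LinearMap.coe_toAffineMap, Submodule.coe_subtype, AffineMap.const_apply, Subtype.exists]
    constructor
    · intro hx
      exact ⟨x - p, AffineSubspace.vsub_mem_direction hx hp, by simp⟩
    · rintro ⟨v, hv, rfl⟩
      exact AffineSubspace.vadd_mem_of_mem_direction hv hp

theorem mem_Icc (hI : τ.Mem (Icc (0 : ℝ) 1)) (a b : ℝ) : τ.Mem (Icc a b) := by
  rcases lt_trichotomy a b with hab | rfl | hab
  · convert hI.preimage_line (-a / (b - a)) (1 / (b - a)) using 1
    ext t
    have hd : 0 < b - a := sub_pos.2 hab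
    have : -a / (b - a) + t • (1 / (b - a)) = (t - a) / (b - a) := by
      simp only [smul_eq_mul]; ring
    simp only [Set.mem_Icc, mem_ofPred_eq, this]
    rw [div_le_one hd, le_div_iff₀ hd]
    simp
  · simpa using h.mem_singleton a
  · simpa [hab] using h.mem_empty

theorem mem_Ioo (hI : τ.Mem (Ioo (0 : ℝ) 1)) (a b : ℝ) : τ.Mem (Ioo a b) := by
  rcases lt_or_ge a b with hab | hab
  · convert hI.preimage_line (-a / (b - a)) (1 / (b - a)) using 1
    ext t
    have hd : 0 < b - a := sub_pos.2 hab
    have : -a / (b - a) + t • (1 / (b - a)) = (t - a) / (b - a) := by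
      simp only [smul_eq_mul]; ring
    simp only [Set.mem_Ioo, mem_ofPred_eq, this]
    rw [div_lt_one hd, lt_div_iff₀ hd]
    simp
  · simpa [hab] using h.mem_empty

/-- A convex interval containing `0` and `1` but not the whole line yields `[0, 1]`. -/
theorem mem_Icc_of_convex {J : Set ℝ} (hJ : τ.Mem J) (hJc : Convex ℝ J) (h0 : 0 ∈ J) (h1 : 1 ∈ J)
    {c : ℝ} (hc : c ∉ J) : τ.Mem (Icc (0 : ℝ) 1) := by
  wlog hc1 : 1 < c generalizing J c
  · have hc0 : c < 0 := by
      by_contra hc0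
      exact hc (hJc.ordConnected.out h0 h1 ⟨not_lt.1 hc0, not_lt.1 hc1⟩)
    have hconv : Convex ℝ {t : ℝ | 1 + t • (-1 : ℝ) ∈ J} :=
      (by
        intro x hx y hy a b ha hb hab
        have := hJc hx hy ha hb hab
        have e : a • (1 + x • (-1 : ℝ)) + b • (1 + y • (-1 : ℝ)) =
            1 + (a • x + b • y) • (-1 : ℝ) := by
          simp only [smul_eq_mul]; linear_combination hab
        rw [e] at this
        exact this)
    exact this (hJ.preimage_line 1 (-1)) hconv (by simpa using h1) (by simpa using h0)
      (c := 1 - c) (by simpa using hc) (by linarith)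
  have hbdd : BddAbove J := ⟨c, fun x hx => by
    by_contra hxc
    exact hc (hJc.ordConnected.out h0 hx ⟨by linarith, (not_le.1 hxc).le⟩)⟩
  have hs : 1 ≤ sSup J := le_csSup hbdd h1
  -- Any `y` in `J` above `sSup J / a` works. Rescaling `J` by such a `y` then keeps `[0, 1]` and
  -- excludes `a`.
  have key : ∀ a : ℝ, 1 < a → ∃ y : ℝ, 0 < y ∧ y ∈ J ∧ y * a ∉ J := by
    intro a ha
    obtain ⟨y, hy, hya⟩ := exists_lt_of_lt_csSup ⟨0, h0⟩
      (show sSup J / a < sSup J from div_lt_self (by linarith) ha)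
    rw [div_lt_iff₀ (by linarith)] at hya
    refine ⟨y, ?_, hy, fun hyJ => absurd (le_csSup hbdd hyJ) (not_le.2 hya)⟩
    by_contra hy0
    nlinarith
  have hseg : ∀ y ∈ J, ∀ t : ℝ, 0 ≤ t → t ≤ 1 → t * y ∈ J := by
    intro y hy t ht0 ht1
    have := hJc h0 hy (sub_nonneg.2 ht1) ht0 (by ring)
    simpa using this
  refine h.mem_of_forall_notMem fun a ha => ?_
  rcases lt_or_ge 1 a with ha1 | ha1
  · obtain ⟨y, -, hyJ, hya⟩ := key a ha1
    refine ⟨_, hJ.preimage_line 0 y, fun t ht => ?_, ?_⟩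
    · simpa using hseg y hyJ t ht.1 ht.2
    · simpa [mul_comm] using hya
  · have ha0 : a < 0 := by
      by_contra h2
      exact ha ⟨not_lt.1 h2, ha1⟩
    obtain ⟨y, -, hyJ, hya⟩ := key (1 - a) (by linarith)
    refine ⟨_, hJ.preimage_line y (-y), fun t ht => ?_, ?_⟩
    · have := hseg y hyJ (1 - t) (by linarith [ht.2]) (by linarith [ht.1])
      have e : y + t • (-y) = (1 - t) * y := by simp only [smul_eq_mul]; ring
      simpa only [mem_ofPred_eq, e] using this
    · have e : y + a • (-y) = y * (1 - a) := by simp only [smul_eq_mul]; ring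
      simpa only [mem_ofPred_eq, e] using hya

/-- A convex set containing the whole line through any two of its points is affine, so a non-affine
member has a line section to which `mem_Icc_of_convex` applies. -/
theorem mem_Icc_of_not_affine (hτ : ∀ (n : ℕ) (S : Set (Fin n → ℝ)), S ∈ τ n → Convex ℝ S)
    {n : ℕ} {S : Set (Fin n → ℝ)} (hS : S ∈ τ n) (hSa : S ∉ affineFamily n) :
    τ.Mem (Icc (0 : ℝ) 1) := by
  have hSc := hτ n S hS
  by_contra hI
  have hline : ∀ x ∈ S, ∀ y ∈ S, ∀ t : ℝ, x + t • (y - x) ∈ S := by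
    intro x hx y hy t
    by_contra ht
    have hJ := (h.mem_of_mem hS).preimage_line x (y - x)
    exact hI (h.mem_Icc_of_convex hJ (hJ.convex hτ) (by simpa using hx) (by simpa using hy) ht)
  refine hSa ⟨⟨S, fun c p₁ p₂ p₃ h₁ h₂ h₃ => ?_⟩, rfl⟩
  -- The required point `c • (p₁ - p₂) + p₃` is the midpoint of a point on the line `p₂p₁` and one
  -- on the line `p₂p₃`.
  have := hSc (hline p₂ h₂ p₁ h₁ (2 * c)) (hline p₂ h₂ p₃ h₃ 2) (a := 1 / 2) (b := 1 / 2)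
    (by norm_num) (by norm_num) (by norm_num)
  convert this using 1
  simp only [vsub_eq_sub, vadd_eq_add]
  module

/-- Whether `0 ∈ J` does not matter: the translates of `J` to the left intersect in the closed ray.
-/
theorem mem_Ici_of_ray {J : Set ℝ} (hJ : τ.Mem J) (hpos : ∀ t : ℝ, 0 < t → t ∈ J)
    (hneg : ∀ t : ℝ, t < 0 → t ∉ J) : τ.Mem (Ici (0 : ℝ)) := by
  refine h.mem_of_forall_notMem fun a ha => ?_
  have ha' : a < 0 := not_le.1 ha
  refine ⟨_, hJ.preimage_line (-a / 2) 1, fun t ht => hpos _ ?_, hneg _ ?_⟩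
  · have : 0 ≤ t := ht
    simp only [smul_eq_mul]; linarith
  · simp only [smul_eq_mul]; linarith

/-- The half-spaces `x + 2ly + l²z ≥ 0` intersect in the cone of positive semidefinite matrices with
rows `(x, y)` and `(y, z)`. Its projection to `(x, y)` is not closed: `x = 0` forces `y = 0`, while
`x > 0` allows every `y`, with `z = y²/x`. -/
theorem mem_halfPlaneWedge (hI : τ.Mem (Ici (0 : ℝ))) : τ.Mem halfPlaneWedge := by
  have hcone : τ.Mem (⋂ l : ℝ, {q : (ℝ × ℝ) × ℝ | q.1.1 + 2 * l * q.1.2 + l ^ 2 * q.2 ∈ Ici 0}) := by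
    refine h.mem_iInter fun l => ?_
    convert hI.preimage_functional (LinearMap.fst ℝ ℝ ℝ ∘ₗ LinearMap.fst ℝ (ℝ × ℝ) ℝ +
      (2 * l) • (LinearMap.snd ℝ ℝ ℝ ∘ₗ LinearMap.fst ℝ (ℝ × ℝ) ℝ) +
      l ^ 2 • LinearMap.snd ℝ (ℝ × ℝ) ℝ) 0 using 1
    ext q
    simp
  convert h.mem_image hcone (LinearMap.fst ℝ (ℝ × ℝ) ℝ).toAffineMap using 1
  ext ⟨x, y⟩
  simp only [halfPlaneWedge, mem_ofPred_eq, Set.mem_image, Set.mem_iInter, mem_Ici,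
    LinearMap.coe_toAffineMap, LinearMap.fst_apply, Prod.exists, exists_and_right, exists_eq_right,
    Prod.mk_eq_zero]
  constructor
  · rintro (hx | ⟨rfl, rfl⟩)
    · refine ⟨y ^ 2 / x, fun l => ?_⟩
      have : x + 2 * l * y + l ^ 2 * (y ^ 2 / x) = (x + l * y) ^ 2 / x := by
        field_simp
        ring
      change 0 ≤ x + 2 * l * y + l ^ 2 * (y ^ 2 / x)
      rw [this]
      positivity
    · exact ⟨0, fun l => by simp⟩
  · rintro ⟨z, hz⟩
    have h0 : 0 ≤ x := by simpa using hz 0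
    rcases h0.lt_or_eq with h0 | rfl
    · exact Or.inl h0
    · refine Or.inr ⟨rfl, ?_⟩
      by_contra hy
      have hz1 : 0 < |z| + 1 := by positivity
      -- For `x = 0` the form `2ly + l²z` is negative when `l` is small and opposite in sign to `y`;
      -- the denominator `|z| + 1` makes it small enough.
      have h1 := hz (-y / (|z| + 1))
      have h2 : (0 : ℝ) + 2 * (-y / (|z| + 1)) * y + (-y / (|z| + 1)) ^ 2 * z =
          y ^ 2 / (|z| + 1) ^ 2 * (z - 2 * (|z| + 1)) := by
        field_simp
        ring
      rw [h2] at h1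
      have h3 : 0 < y ^ 2 / (|z| + 1) ^ 2 := by positivity
      nlinarith [le_abs_self z, abs_nonneg z]

theorem mem_halfPlaneWedge_of_not_rayFree {F : Type} [NormedAddCommGroup F] [NormedSpace ℝ F]
    {T : Set F} (hT : τ.Mem T) (hr : ¬ RayFree T) : τ.Mem halfPlaneWedge := by
  simp only [RayFree, not_forall, not_exists, not_and] at hr
  obtain ⟨v, w, hpos, hneg⟩ := hr
  exact h.mem_halfPlaneWedge (h.mem_Ici_of_ray (hT.preimage_line v w) hpos hneg)

/-- Lines at height `1` miss the boundary point, so they meet the wedge in open rays. -/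
theorem mem_Ioo_of_halfPlaneWedge (hW : τ.Mem halfPlaneWedge) : τ.Mem (Ioo (0 : ℝ) 1) := by
  convert h.mem_inter (hW.preimage_line (0, 1) (1, 0)) (hW.preimage_line (1, 1) (-1, 0)) using 1
  ext t
  simp [halfPlaneWedge]

theorem mem_stripWedge_of_halfPlaneWedge (hI : τ.Mem (Icc (0 : ℝ) 1))
    (hW : τ.Mem halfPlaneWedge) : τ.Mem stripWedge := by
  convert h.mem_inter hW (hI.preimage_functional (LinearMap.fst ℝ ℝ ℝ) 0) using 1
  ext ⟨x, y⟩
  simp only [stripWedge, halfPlaneWedge, mem_ofPred_eq, mem_inter_iff, Prod.mk_eq_zero, Set.mem_Icc,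
    LinearMap.fst_apply, add_zero]
  constructor
  · rintro (h1 | ⟨rfl, rfl⟩)
    · exact ⟨Or.inl h1.1, h1.1.le, h1.2⟩
    · simp
  · rintro ⟨h1 | h1, h2⟩
    · exact Or.inl ⟨h1, h2.2⟩
    · exact Or.inr h1

theorem mem_boxWedge_of_stripWedge (hI : τ.Mem (Icc (0 : ℝ) 1))
    (hV : τ.Mem stripWedge) : τ.Mem boxWedge := by
  rw [boxWedge_eq_inter]
  simpa using h.mem_inter hV (hI.preimage_functional (LinearMap.snd ℝ ℝ ℝ) 0)

end GeometricallyClosed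

end Generators

/-! ### Compact sets plus subspaces -/

section Compact

open Set

variable {E : Type} [NormedAddCommGroup E] [NormedSpace ℝ E] [FiniteDimensional ℝ E]
  {τ : RealFamily}

/-- `K + V` is closed, so an outside point is strictly separated from it. The separating functional
vanishes on `V` and is bounded on `K`, which places `K + V` in a slab over a compact interval. -/
theorem GeometricallyClosed.mem_compact_add_submodule (h : GeometricallyClosed τ)
    (hI : τ.Mem (Icc (0 : ℝ) 1)) {K : Set E} (hK : IsCompact K) (hKc : Convex ℝ K)
    (V : Submodule ℝ E) : τ.Mem (K + (V : Set E)) := by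
  refine h.mem_of_forall_notMem fun a ha => ?_
  obtain ⟨f, u, hfa, hf⟩ := geometric_hahn_banach_point_closed (hKc.add V.convex)
    (V.closed_of_finiteDimensional.add_left_of_isCompact hK) ha
  obtain ⟨M, hM⟩ := (hK.image f.continuous).bddAbove
  refine ⟨_, (h.mem_Icc hI u M).preimage_functional (f : E →ₗ[ℝ] ℝ) 0, ?_, ?_⟩
  · rintro _ ⟨k, hk, v, hv, rfl⟩
    have hv0 : f v = 0 := Submodule.eq_zero_of_forall_le (p := (f : E →ₗ[ℝ] ℝ)) (s := k) (c := u)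
      (fun v hv => (hf _ ⟨k, hk, v, hv, rfl⟩).le) hv
    have h1 := hf _ ⟨k, hk, v, hv, rfl⟩
    have h2 := hM ⟨k, hk, rfl⟩
    simp only [map_add, hv0, add_zero] at h1
    simpa [hv0] using ⟨h1.le, h2⟩
  · simp [hfa]

/-- A ray-free member that is not closed misses some `a` in its closure. On the line from `a` to a
relative interior point `r` the section stops strictly after `a`; intersecting with its reversal
opens the other end too. -/
theorem GeometricallyClosed.mem_Ioo_of_not_compact (h : GeometricallyClosed τ)
    (hτ : ∀ (n : ℕ) (S : Set (Fin n → ℝ)), S ∈ τ n → Convex ℝ S)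
    {n : ℕ} {S : Set (Fin n → ℝ)} (hS : S ∈ τ n) (hSk : S ∉ compactFamily n) :
    τ.Mem (Ioo (0 : ℝ) 1) := by
  have hSc := hτ n S hS
  by_cases hr : RayFree S
  swap
  · exact h.mem_Ioo_of_halfPlaneWedge (h.mem_halfPlaneWedge_of_not_rayFree (h.mem_of_mem hS) hr)
  have hne : S.Nonempty := by
    rw [nonempty_iff_ne_empty]
    rintro rfl
    exact hSk ⟨∅, ⊥, isCompact_empty, convex_empty, by simp⟩
  have hncl : ¬ IsClosed S := by
    intro hcl
    obtain ⟨K, V, hK, hKc, hKV, -⟩ := hr.exists_closure_eq hSc hne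
    exact hSk ⟨K, V, hK, hKc, by rw [← hKV, hcl.closure_eq]⟩
  obtain ⟨a, ha, haS⟩ : ∃ a ∈ closure S, a ∉ S := by
    by_contra! hcon
    exact hncl (isClosed_of_closure_subset hcon)
  obtain ⟨r, hrS, hcore⟩ := hSc.exists_combo_mem_of_mem_closure hne
  have hJ := (h.mem_of_mem hS).preimage_line a (r - a)
  have hJ' := (h.mem_of_mem hS).preimage_line r (a - r)
  convert h.mem_inter hJ hJ' using 1
  have hmem : ∀ x : ℝ, 0 < x → x ≤ 1 → a + x • (r - a) ∈ S := fun x h0 h1 => by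
    have := hcore a ha x h0 h1
    convert this using 1
    module
  have hpos : ∀ x : ℝ, a + x • (r - a) ∈ S → 0 < x := by
    intro x hx
    by_contra hx0
    have hx0 := not_lt.1 hx0
    have h1 := hJ.convex hτ
    have h2 : (0 : ℝ) ∈ {t : ℝ | a + t • (r - a) ∈ S} :=
      h1.ordConnected.out hx (hmem 1 one_pos le_rfl) ⟨hx0, zero_le_one⟩
    exact haS (by simpa using h2)
  have hsym : ∀ x : ℝ, r + x • (a - r) = a + (1 - x) • (r - a) := fun x => by module
  ext x
  simp only [Set.mem_Ioo, mem_inter_iff, mem_ofPred_eq, hsym]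
  constructor
  · rintro ⟨h0, h1⟩
    exact ⟨hmem x h0 h1.le, hmem _ (by linarith) (by linarith)⟩
  · rintro ⟨h0, h1⟩
    exact ⟨hpos x h0, by linarith [hpos _ h1]⟩

end Compact

/-! ### Hulls of point families -/

section Hulls

open Set Module

variable {τ : RealFamily}

theorem RealFamily.mem_hull_of_affineMap {E F : Type} [AddCommGroup E] [Module ℝ E]
    [AddCommGroup F] [Module ℝ F] {I : Type*} {x : I → E} {a : E} (ha : a ∈ τ.hull x)
    (A : E →ᵃ[ℝ] F) {b : F} {y : I → F} (hb : A a = b) (hy : ∀ i, A (x i) = y i) :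
    b ∈ τ.hull y := by
  have := RealFamily.map_mem_hull ha A
  simpa only [hb, hy] using this

theorem RealFamily.mem_hull_of_map {E F : Type} [AddCommGroup E] [Module ℝ E] [AddCommGroup F]
    [Module ℝ F] {I : Type*} {x : I → E} {a : E} (ha : a ∈ τ.hull x) (A : E →ₗ[ℝ] F) {b : F}
    {y : I → F} (hb : A a = b) (hy : ∀ i, A (x i) = y i) : b ∈ τ.hull y :=
  RealFamily.mem_hull_of_affineMap ha A.toAffineMap hb hy

theorem Bornology.IsBounded.exists_abs_le {E : Type} [NormedAddCommGroup E] [NormedSpace ℝ E]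
    {S : Set E} (hS : Bornology.IsBounded S) (p : E →L[ℝ] ℝ) : ∃ C > 0, ∀ s ∈ S, |p s| ≤ C := by
  obtain ⟨R, hR0, hR⟩ := hS.exists_pos_norm_le
  refine ⟨‖p‖ * R + 1, by positivity, fun s hs => ?_⟩
  have h1 := p.le_opNorm s
  have h2 := mul_le_mul_of_nonneg_left (hR s hs) (norm_nonneg p)
  rw [Real.norm_eq_abs] at h1
  linarith

theorem Convex.preimage_add_submodule {E : Type} [AddCommGroup E] [Module ℝ E] {S : Set E}
    (hS : Convex ℝ S) (K : Submodule ℝ E) (b : E) : Convex ℝ {k : K | b + k ∈ S} := by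
  intro x hx y hy s t hs ht hst
  have h1 := hS hx hy hs ht hst
  have h2 : s • (b + (x : E)) + t • (b + (y : E)) = (s + t) • b + (s • (x : E) + t • (y : E)) := by
    module
  rw [h2, hst, one_smul] at h1
  exact h1

theorem Bornology.IsBounded.preimage_add_submodule {E : Type} [NormedAddCommGroup E]
    [NormedSpace ℝ E] {S : Set E} (hS : Bornology.IsBounded S) (K : Submodule ℝ E) (b : E) :
    Bornology.IsBounded {k : K | b + k ∈ S} := by
  obtain ⟨R, hR⟩ := isBounded_iff_forall_norm_le.1 hS
  refine isBounded_iff_forall_norm_le.2 ⟨R + ‖b‖, fun k hk => ?_⟩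
  have h1 := hR _ hk
  have h2 := norm_sub_le (b + (k : E)) b
  rw [add_sub_cancel_left] at h2
  rw [Submodule.norm_coe] at h2
  linarith

theorem SemidentFree.preimage_add_submodule {E : Type} [NormedAddCommGroup E]
    [NormedSpace ℝ E] {S : Set E} (hS : SemidentFree S) (K : Submodule ℝ E) (b : E) :
    SemidentFree {k : K | b + k ∈ S} := by
  intro s hs t ht l hl
  have hcont : Continuous fun k : K => b + (k : E) := by fun_prop
  have ht' : b + (t : E) ∈ closure S := hcont.closure_preimage_subset S ht
  have := hS _ hs _ ht' l hl
  have e : l • (b + (s : E)) + (1 - l) • (b + (t : E)) = b + (l • (s : E) + (1 - l) • (t : E)) := by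
    module
  rw [e] at this
  exact this

theorem RayFree.preimage_add_submodule {E : Type} [NormedAddCommGroup E]
    [NormedSpace ℝ E] {S : Set E} (hS : RayFree S) (K : Submodule ℝ E) (b : E) :
    RayFree {k : K | b + k ∈ S} := by
  intro v w hvw
  obtain ⟨x, hx, hxS⟩ := hS (b + v) w fun x hx => by
    have : b + ((v + x • w : K) : E) ∈ S := hvw x hx
    simpa [add_assoc] using this
  refine ⟨x, hx, ?_⟩
  change b + ((v + x • w : K) : E) ∈ S
  simpa [add_assoc] using hxS

theorem finrank_ker_lt {E : Type} [NormedAddCommGroup E] [NormedSpace ℝ E] [FiniteDimensional ℝ E]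
    {p : E →L[ℝ] ℝ} (hp : p ≠ 0) : finrank ℝ (LinearMap.ker (p : E →ₗ[ℝ] ℝ)) < finrank ℝ E := by
  apply Submodule.finrank_lt
  intro h
  apply hp
  ext x
  exact LinearMap.mem_ker.1 (h ▸ Submodule.mem_top : x ∈ LinearMap.ker (p : E →ₗ[ℝ] ℝ))

/-- The common induction on dimension for the three wedges. `C` is a class of convex sets stable
under restriction to translated subspaces. `hkill` says that where the mean of `p` attains a lower
bound `c`, the indices with `p (x i) ≠ c` contribute nothing to the mean of any affine function. -/
theorem GeometricallyClosed.hull_subset_of_indicator_eq_zero (h : GeometricallyClosed τ)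
    (C : ∀ (E : Type) [NormedAddCommGroup E] [NormedSpace ℝ E], Set E → Prop)
    (hconv : ∀ (E : Type) [NormedAddCommGroup E] [NormedSpace ℝ E] (S : Set E),
      C E S → Convex ℝ S)
    (hpre : ∀ (E : Type) [NormedAddCommGroup E] [NormedSpace ℝ E] (S : Set E) (K : Submodule ℝ E)
      (b : E), C E S → C K {k : K | b + k ∈ S})
    (hkill : ∀ (E : Type) [NormedAddCommGroup E] [NormedSpace ℝ E] [FiniteDimensional ℝ E]
      (S : Set E), C E S → ∀ (I : Type) (x : I → E), (∀ i, x i ∈ S) → ∀ (p : E →L[ℝ] ℝ) (c : ℝ),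
      (∀ s ∈ S, c ≤ p s) → ∀ (q : E →L[ℝ] ℝ) (k z : ℝ),
      ((0, z) : ℝ × ℝ) ∈ τ.hull (fun i => (p (x i) - c,
        {i | p (x i) ≠ c}.indicator (fun i => q (x i) + k) i)) → z = 0)
    {E : Type} [NormedAddCommGroup E] [NormedSpace ℝ E] [FiniteDimensional ℝ E] {S : Set E}
    (hS : C E S) {I : Type} {x : I → E} (hx : ∀ i, x i ∈ S) {a : E} (ha : a ∈ τ.hull x) :
    a ∈ S := by
  induction hd : finrank ℝ E using Nat.strong_induction_on generalizing E S x a with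
  | _ d ih =>
  subst hd
  by_contra haS
  obtain ⟨i₁⟩ := h.nonempty_of_mem_hull ha
  obtain ⟨p, hp0, hp⟩ := (hconv E S hS).exists_ne_zero_forall_le ⟨_, hx i₁⟩ haS
  set N : Set I := {i | p (x i) ≠ p a} with hN
  -- `u` and `ν` are the contribution and the weight of the indices off the hyperplane `p = p a`;
  -- `hkill` makes both vanish.
  obtain ⟨⟨u, ν⟩, hu⟩ := h.exists_prod_mem_hull ha
    (fun i => (N.indicator x i, N.indicator (fun _ => (1 : ℝ)) i))
  have hval : ∀ (q : E →L[ℝ] ℝ) (k : ℝ), q u + k * ν = 0 := by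
    intro q k
    refine hkill E S hS I x hx p (p a) hp q k _ ?_
    refine RealFamily.mem_hull_of_affineMap hu ((LinearMap.prod
      ((p : E →ₗ[ℝ] ℝ) ∘ₗ LinearMap.fst ℝ E (E × ℝ))
      (((q : E →ₗ[ℝ] ℝ) ∘ₗ LinearMap.fst ℝ E ℝ + k • LinearMap.snd ℝ E ℝ) ∘ₗ
        LinearMap.snd ℝ E (E × ℝ))).toAffineMap + AffineMap.const ℝ _ ((-p a, 0) : ℝ × ℝ)) ?_ fun i => ?_
    · simp
    · refine Prod.ext (by simp [sub_eq_add_neg]) ?_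
      by_cases hi : p (x i) = p a <;> simp [hi, hN]
  have hu0 : u = 0 := by
    refine SeparatingDual.eq_zero_of_forall_dual_eq_zero (R := ℝ) fun q => ?_
    simpa using hval q 0
  have hν0 : ν = 0 := by simpa using hval 0 1
  subst hu0 hν0
  -- If every index were in `N`, the weight `ν` would be `1`.
  obtain ⟨i₀, hi₀⟩ : ∃ i, i ∉ N := by
    by_contra! hall
    have := hu _ ((h.mem_singleton (1 : ℝ)).preimage
      (LinearMap.snd ℝ E ℝ ∘ₗ LinearMap.snd ℝ E (E × ℝ)).toAffineMap) (fun i => by simp [hall i])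
    simp at this
  have hi₀ : p (x i₀) = p a := by simpa [hN] using hi₀
  let K := LinearMap.ker (p : E →ₗ[ℝ] ℝ)
  obtain ⟨Q, hQ⟩ := LinearMap.exists_leftInverse_of_injective K.subtype K.ker_subtype
  have hQK : ∀ y : E, p y = p a → ((Q (y - a) : K) : E) = y - a := by
    intro y hy
    have := LinearMap.congr_fun hQ (⟨y - a, by simp [K, hy]⟩ : K)
    simpa using congrArg Subtype.val this
  -- Points off the hyperplane carry no weight, so replacing them by `x i₀` keeps `a` in the hull
  -- and moves all points into the hyperplane.
  let y : I → E := fun i => x i - N.indicator x i + N.indicator (fun _ => (1 : ℝ)) i • x i₀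
  have hy : a ∈ τ.hull y := by
    refine RealFamily.mem_hull_of_map hu (LinearMap.fst ℝ E (E × ℝ) -
      LinearMap.fst ℝ E ℝ ∘ₗ LinearMap.snd ℝ E (E × ℝ) +
      (LinearMap.snd ℝ E ℝ ∘ₗ LinearMap.snd ℝ E (E × ℝ)).smulRight (x i₀)) ?_ fun i => ?_
    · simp
    · simp [y]
  have hyS : ∀ i, p (y i) = p a ∧ y i ∈ S := by
    intro i
    by_cases hi : i ∈ N
    · simpa [y, hi] using ⟨hi₀, hx i₀⟩
    · have : p (x i) = p a := by simpa [hN] using hi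
      simpa [y, hi] using ⟨this, hx i⟩
  have hfin := ih _ (finrank_ker_lt hp0) (hpre E S K a hS) (x := fun i => Q (y i - a))
    (a := (0 : K)) (fun i => by
      change a + ((Q (y i - a) : K) : E) ∈ S
      rw [hQK _ (hyS i).1]
      simpa using (hyS i).2) (by
      have := RealFamily.map_mem_hull hy (Q.toAffineMap + AffineMap.const ℝ E (-Q a))
      simpa [sub_eq_add_neg] using this) rfl
  have : a + ((0 : K) : E) ∈ S := hfin
  exact haS (by simpa using this)

theorem GeometricallyClosed.mem_of_convex (h : GeometricallyClosed τ) (hW : τ.Mem halfPlaneWedge)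
    {E : Type} [NormedAddCommGroup E] [NormedSpace ℝ E] [FiniteDimensional ℝ E] {S : Set E}
    (hS : Convex ℝ S) : τ.Mem S := by
  refine h.mem_of_forall_hull fun a ha =>
    h.hull_subset_of_indicator_eq_zero (fun E _ _ S => Convex ℝ S) (fun E _ _ S hS => hS)
    (fun E _ _ S K b hS => hS.preimage_add_submodule K b) ?_ hS (fun i => i.2) ha
  intro E _ _ _ S hS I x hx p c hp q k z hz
  have := hz _ hW fun i => by
    by_cases hi : p (x i) = c
    · exact Or.inr (by simp [hi])
    · exact Or.inl (sub_pos.2 (lt_of_le_of_ne (hp _ (hx i)) (Ne.symm hi)))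
  simpa [halfPlaneWedge] using this

/-- Since `p` is bounded below on `S` it is also bounded above, so after rescaling the pairs in
`hkill` lie in the strip; their second coordinate may be unbounded. -/
theorem GeometricallyClosed.mem_of_rayFree (h : GeometricallyClosed τ) (hV : τ.Mem stripWedge)
    {E : Type} [NormedAddCommGroup E] [NormedSpace ℝ E] [FiniteDimensional ℝ E] {S : Set E}
    (hS : Convex ℝ S) (hr : RayFree S) : τ.Mem S := by
  refine h.mem_of_forall_hull fun a ha =>
    h.hull_subset_of_indicator_eq_zero (fun E _ _ S => Convex ℝ S ∧ RayFree S)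
    (fun E _ _ S hS => hS.1)
    (fun E _ _ S K b hS => ⟨hS.1.preimage_add_submodule K b, hS.2.preimage_add_submodule K b⟩)
    ?_ ⟨hS, hr⟩ (fun i => i.2) ha
  intro E _ _ _ S hS I x hx p c hp q k z hz
  obtain ⟨M, hM⟩ := hS.2.exists_forall_le hS.1 p hp
  obtain ⟨i₁⟩ := h.nonempty_of_mem_hull hz
  have hMc : 0 < M - c + 1 := by linarith [hp _ (hx i₁), hM _ (hx i₁)]
  have := hz _ (hV.preimage (LinearMap.prodMap ((M - c + 1)⁻¹ • LinearMap.id)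
      (LinearMap.id (R := ℝ) (M := ℝ))).toAffineMap) fun i => by
    by_cases hi : p (x i) = c
    · exact Or.inr (by simp [hi])
    · have h1 : 0 < p (x i) - c := sub_pos.2 (lt_of_le_of_ne (hp _ (hx i)) (Ne.symm hi))
      refine Or.inl ⟨?_, ?_⟩
      · simpa using mul_pos (inv_pos.2 hMc) h1
      · have : (M - c + 1)⁻¹ * (p (x i) - c) ≤ 1 := by
          rw [inv_mul_le_iff₀ hMc]
          linarith [hM _ (hx i)]
        simpa using this
  simpa [stripWedge] using this

theorem GeometricallyClosed.mem_of_isBounded (h : GeometricallyClosed τ) (hU : τ.Mem boxWedge)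
    {E : Type} [NormedAddCommGroup E] [NormedSpace ℝ E] [FiniteDimensional ℝ E] {S : Set E}
    (hS : Convex ℝ S) (hb : Bornology.IsBounded S) : τ.Mem S := by
  refine h.mem_of_forall_hull fun a ha =>
    h.hull_subset_of_indicator_eq_zero (fun E _ _ S => Convex ℝ S ∧ Bornology.IsBounded S)
    (fun E _ _ S hS => hS.1)
    (fun E _ _ S K b hS => ⟨hS.1.preimage_add_submodule K b, hS.2.preimage_add_submodule K b⟩)
    ?_ ⟨hS, hb⟩ (fun i => i.2) ha
  intro E _ _ _ S hS I x hx p c hp q k z hz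
  obtain ⟨M, hM0, hM⟩ := hS.2.exists_abs_le p
  obtain ⟨R, hR0, hR⟩ := hS.2.exists_abs_le q
  set D : ℝ := M + |c|
  have hD : 0 < D := by positivity
  set B : ℝ := R + |k|
  have hB : 0 < B := by positivity
  have hpD : ∀ i, p (x i) ≠ c → 0 < D⁻¹ * (p (x i) - c) ∧ D⁻¹ * (p (x i) - c) ≤ 1 := by
    intro i hi
    have h1 : 0 < p (x i) - c := sub_pos.2 (lt_of_le_of_ne (hp _ (hx i)) (Ne.symm hi))
    refine ⟨mul_pos (inv_pos.2 hD) h1, ?_⟩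
    rw [inv_mul_le_iff₀ hD]
    linarith [le_abs_self (p (x i)), hM _ (hx i), neg_abs_le c]
  have hqB : ∀ i, 0 ≤ (2 * B)⁻¹ * (q (x i) + k + B) ∧ (2 * B)⁻¹ * (q (x i) + k + B) ≤ 1 := by
    intro i
    have h1 := abs_le.1 (hR _ (hx i))
    have h2 := neg_abs_le k
    have h3 := le_abs_self k
    constructor
    · exact mul_nonneg (by positivity) (by linarith [h1.1])
    · rw [inv_mul_le_iff₀ (by positivity)]
      linarith [h1.2]
  -- The box also requires a second coordinate in `[0, 1]`. The weight `ν` of the indicator is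
  -- killed first, so that the shift by `B` making `q + k` nonnegative does not change the mean.
  obtain ⟨ν, hν⟩ := h.exists_prod_mem_hull hz
    ({i | p (x i) ≠ c}.indicator (fun _ => (1 : ℝ)))
  have h1 := hν _ (hU.preimage (LinearMap.prodMap (D⁻¹ • LinearMap.fst ℝ ℝ ℝ)
      (LinearMap.id (R := ℝ) (M := ℝ))).toAffineMap) fun i => by
    by_cases hi : p (x i) = c
    · exact Or.inr (by simp [hi])
    · exact Or.inl (by simpa [hi] using hpD i hi)
  have hν0 : ν = 0 := by simpa [boxWedge] using h1
  have h2 := hν _ (hU.preimage (LinearMap.prod (D⁻¹ • LinearMap.fst ℝ ℝ ℝ ∘ₗ LinearMap.fst ℝ _ _)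
      ((2 * B)⁻¹ • (LinearMap.snd ℝ ℝ ℝ ∘ₗ LinearMap.fst ℝ _ _ + B • LinearMap.snd ℝ _ ℝ))
      ).toAffineMap) fun i => by
    by_cases hi : p (x i) = c
    · exact Or.inr (by simp [hi])
    · refine Or.inl ⟨?_, ?_, ?_⟩
      · simpa using (hpD i hi).1
      · simpa using (hpD i hi).2
      · have := hqB i
        simpa only [hi, mem_ofPred_eq, ne_eq, not_false_eq_true, indicator_of_mem,
          LinearMap.coe_toAffineMap, LinearMap.prod_apply, Function.prod, LinearMap.smul_apply,
          LinearMap.add_apply, LinearMap.comp_apply, LinearMap.fst_apply, LinearMap.snd_apply,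
          smul_eq_mul, mul_one] using this
  simpa [boxWedge, hν0, hB.ne'] using h2

/-- If the weighted point `(a, l)` lies in the hull of the points `x i`, `i ∈ Z`, with weight one
and of zero otherwise, witnessed by a function `e` that is positive outside `Z`, then `l⁻¹ • a`
belongs to every bounded convex semident-free set containing the points `x i`, `i ∈ Z`. -/
theorem GeometricallyClosed.inv_smul_mem_of_semidentFree (h : GeometricallyClosed τ)
    (hI : τ.Mem (Icc (0 : ℝ) 1)) (hO : τ.Mem (Ioo (0 : ℝ) 1)) {E : Type} [NormedAddCommGroup E]
    [NormedSpace ℝ E] [FiniteDimensional ℝ E] {S : Set E} (hS : Convex ℝ S)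
    (hb : Bornology.IsBounded S) (hs : SemidentFree S) {I : Type} {Z : Set I} {x : I → E}
    (hx : ∀ i ∈ Z, x i ∈ S) {e : I → ℝ} {M : ℝ} (he : ∀ i, 0 ≤ e i ∧ e i ≤ M)
    (heZ : ∀ i ∉ Z, 0 < e i) {a : E} {l : ℝ}
    (ha : (a, l, (0 : ℝ)) ∈ τ.hull
      (fun i => (Z.indicator x i, Z.indicator (fun _ => (1 : ℝ)) i, e i))) :
    0 < l ∧ l⁻¹ • a ∈ S := by
  induction hd : finrank ℝ E using Nat.strong_induction_on generalizing E S Z x e M a l with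
  | _ d ih =>
  subst hd
  -- The function `1_Z + e` takes values in the open interval `(0, M + 2)`, and its mean is `l + 0`.
  have hl : 0 < l := by
    have := ha _ ((h.mem_Ioo hO 0 (M + 2)).preimage (LinearMap.fst ℝ ℝ ℝ ∘ₗ LinearMap.snd ℝ E _ +
      LinearMap.snd ℝ ℝ ℝ ∘ₗ LinearMap.snd ℝ E _).toAffineMap) fun i => by
      by_cases hi : i ∈ Z
      · have h1 := he i
        simpa [hi] using (⟨by linarith, by linarith⟩ : 0 < 1 + e i ∧ 1 + e i < M + 2)
      · have h1 := he i
        simpa [hi] using (⟨heZ i hi, by linarith⟩ : 0 < e i ∧ e i < M + 2)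
    simpa using this.1
  refine ⟨hl, ?_⟩
  by_contra hbS
  set b := l⁻¹ • a with hbdef
  obtain ⟨i₁, hi₁⟩ : Z.Nonempty := by
    rw [nonempty_iff_ne_empty]
    rintro rfl
    have := ha _ ((h.mem_singleton (0 : ℝ)).preimage
      (LinearMap.fst ℝ ℝ ℝ ∘ₗ LinearMap.snd ℝ E (ℝ × ℝ)).toAffineMap) (fun i => by simp)
    have hl0 : l = 0 := by simpa using this
    exact hl.ne' hl0
  obtain ⟨p, hp0, hp⟩ := hS.exists_ne_zero_forall_le ⟨_, hx i₁ hi₁⟩ hbS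
  have hpa : p a = p b * l := by
    rw [hbdef, map_smul, smul_eq_mul]
    field_simp
  obtain ⟨C, hC0, hC⟩ := hb.exists_abs_le p
  let K := LinearMap.ker (p : E →ₗ[ℝ] ℝ)
  obtain ⟨Q, hQ⟩ := LinearMap.exists_leftInverse_of_injective K.subtype K.ker_subtype
  have hQK : ∀ y : E, p y = p b → ((Q (y - b) : K) : E) = y - b := by
    intro y hy
    have := LinearMap.congr_fun hQ (⟨y - b, by simp [K, hy]⟩ : K)
    simpa using congrArg Subtype.val this
  -- Induction is applied to the points of `Z` on the supporting hyperplane, with `p (x i) - p b`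
  -- added to the witness on `Z`. The sum is positive off `Z'`, and its mean is still zero since `p
  -- a = p b * l`.
  set Z' : Set I := {i | i ∈ Z ∧ p (x i) = p b} with hZ'
  obtain ⟨⟨u, m⟩, hu⟩ := h.exists_prod_mem_hull ha
    (fun i => (Z'.indicator (fun i => Q (x i - b)) i, Z'.indicator (fun _ => (1 : ℝ)) i))
  have hZ'x : ∀ i ∈ Z', ((Q (x i - b) : K) : E) = x i - b := fun i hi => hQK _ hi.2
  obtain ⟨hm, hmS⟩ := ih _ (finrank_ker_lt hp0) (hS.preimage_add_submodule K b)
    (hb.preimage_add_submodule K b) (hs.preimage_add_submodule K b) (Z := Z')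
    (x := fun i => Q (x i - b)) (fun i hi => by
      change b + ((Q (x i - b) : K) : E) ∈ S
      rw [hZ'x i hi]
      simpa using hx i hi.1)
    (e := fun i => e i + Z.indicator (fun i => p (x i) - p b) i) (M := M + (C + |p b|))
    (fun i => by
      have h1 := he i
      by_cases hi : i ∈ Z
      · have h2 := hp _ (hx i hi)
        have h3 := abs_le.1 (hC _ (hx i hi))
        have h4 := neg_abs_le (p b)
        simp only [hi, indicator_of_mem]
        constructor <;> linarith
      · simp only [hi, not_false_eq_true, indicator_of_notMem]
        have : 0 ≤ C + |p b| := by positivity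
        constructor <;> linarith)
    (fun i hi => by
      by_cases hiZ : i ∈ Z
      · have h1 := (he i).1
        have h2 : p b < p (x i) :=
          lt_of_le_of_ne (hp _ (hx i hiZ)) fun h => hi ⟨hiZ, h.symm⟩
        simp only [hiZ, indicator_of_mem]
        linarith
      · simpa [hiZ] using heZ i hiZ)
    (a := u) (l := m) (by
      refine RealFamily.mem_hull_of_map hu (LinearMap.prod
        (LinearMap.fst ℝ K ℝ ∘ₗ LinearMap.snd ℝ (E × ℝ × ℝ) (K × ℝ)) (LinearMap.prod
        (LinearMap.snd ℝ K ℝ ∘ₗ LinearMap.snd ℝ (E × ℝ × ℝ) (K × ℝ))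
        ((LinearMap.snd ℝ ℝ ℝ ∘ₗ LinearMap.snd ℝ E (ℝ × ℝ) +
          (p : E →ₗ[ℝ] ℝ) ∘ₗ LinearMap.fst ℝ E (ℝ × ℝ) -
          p b • LinearMap.fst ℝ ℝ ℝ ∘ₗ LinearMap.snd ℝ E (ℝ × ℝ)) ∘ₗ
          LinearMap.fst ℝ (E × ℝ × ℝ) (K × ℝ)))) ?_ fun i => ?_
      · simp [hpa]
      · by_cases hi : i ∈ Z
        · simp [hi, add_sub_assoc]
        · simp [hi]) rfl
  have hmS : b + ((m⁻¹ • u : K) : E) ∈ S := hmS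
  -- `a - (u + m • b)` is the contribution of `Z \ Z'`, of total weight `l - m`. It inherits lower
  -- bounds of functionals on `S` through closed intervals.
  have hrem : ∀ (q : E →L[ℝ] ℝ) (k : ℝ), (∀ s ∈ S, k ≤ q s) →
      k * (l - m) ≤ q (a - (u + m • b)) := by
    intro q k hk
    obtain ⟨R, hR0, hR⟩ := hb.exists_abs_le q
    have h1 := hu _ ((h.mem_Icc hI 0 (R + |k|)).preimage
      ((q : E →ₗ[ℝ] ℝ) ∘ₗ (LinearMap.fst ℝ E (ℝ × ℝ) ∘ₗ LinearMap.fst ℝ (E × ℝ × ℝ) (K × ℝ) -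
        K.subtype ∘ₗ LinearMap.fst ℝ K ℝ ∘ₗ LinearMap.snd ℝ (E × ℝ × ℝ) (K × ℝ) -
        (LinearMap.snd ℝ K ℝ ∘ₗ LinearMap.snd ℝ (E × ℝ × ℝ) (K × ℝ)).smulRight b) -
        k • (LinearMap.fst ℝ ℝ ℝ ∘ₗ LinearMap.snd ℝ E (ℝ × ℝ) ∘ₗ
          LinearMap.fst ℝ (E × ℝ × ℝ) (K × ℝ) -
        LinearMap.snd ℝ K ℝ ∘ₗ LinearMap.snd ℝ (E × ℝ × ℝ) (K × ℝ))).toAffineMap) fun i => by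
      have hRk : 0 ≤ R + |k| := by positivity
      by_cases hi : i ∈ Z'
      · have hiZ : i ∈ Z := hi.1
        have hz := congrArg q (hZ'x i hi)
        simp only [map_sub, Submodule.coe_sub] at hz
        simp only [mem_preimage, hi, hiZ, indicator_of_mem]
        simp
        constructor <;> linarith
      · by_cases hiZ : i ∈ Z
        · have h2 := hk _ (hx i hiZ)
          have h3 := abs_le.1 (hR _ (hx i hiZ))
          have h4 := neg_abs_le k
          simpa [hi, hiZ] using (⟨h2, by linarith⟩ : k ≤ q (x i) ∧ q (x i) ≤ R + |k| + k)
        · simpa [hi, hiZ] using hRk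
    have h2 := h1.1
    simp only [LinearMap.coe_toAffineMap, LinearMap.sub_apply, LinearMap.comp_apply,
      LinearMap.smul_apply, LinearMap.smulRight_apply, LinearMap.fst_apply, LinearMap.snd_apply,
      smul_eq_mul, Submodule.coe_subtype, sub_nonneg, ContinuousLinearMap.coe_coe] at h2
    rw [← sub_sub]
    exact h2
  have hnu : 0 ≤ l - m := by
    have := hrem 0 (-1) (fun s _ => by simp)
    simp only [zero_apply] at this
    linarith
  have hadd : l • b = m • (b + ((m⁻¹ • u : K) : E)) + (a - (u + m • b)) := by
    rw [hbdef, smul_inv_smul₀ hl.ne', smul_add, Submodule.coe_smul, smul_inv_smul₀ hm.ne']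
    abel
  rcases hnu.lt_or_eq with hpos | hzero
  -- With positive remaining weight, `b` is a proper combination of a point of `S` and the
  -- normalized remainder, which Hahn–Banach places in the closure of `S`.
  · have ht : (l - m)⁻¹ • (a - (u + m • b)) ∈ closure S := by
      by_contra ht
      obtain ⟨q, k, hqk, hq⟩ := geometric_hahn_banach_point_closed hS.closure isClosed_closure ht
      have h1 := hrem q k fun s hs => (hq s (subset_closure hs)).le
      rw [map_smul, smul_eq_mul, inv_mul_lt_iff₀ hpos] at hqk
      linarith [mul_comm k (l - m)]
    have h1 := hs _ hmS _ ht (m / l) ⟨div_pos hm hl, (div_lt_one hl).2 (by linarith)⟩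
    have h2 : (m / l) • (b + ((m⁻¹ • u : K) : E)) + (1 - m / l) •
        ((l - m)⁻¹ • (a - (u + m • b))) = b := by
      have h3 : (1 - m / l) * (l - m)⁻¹ = l⁻¹ := by
        field_simp
      rw [smul_smul, h3, div_eq_inv_mul, mul_smul, ← smul_add, ← hadd, inv_smul_smul₀ hl.ne']
    rw [h2] at h1
    exact hbS h1
  -- With weight zero the remainder itself vanishes: every functional is bounded on `S`, hence
  -- nonnegative at the remainder, and so is its negative.
  · have hd0 : a - (u + m • b) = 0 := by
      have hge : ∀ q : E →L[ℝ] ℝ, 0 ≤ q (a - (u + m • b)) := by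
        intro q
        obtain ⟨R, -, hR⟩ := hb.exists_abs_le q
        have := hrem q (-R) fun s hs => (abs_le.1 (hR s hs)).1
        rwa [← hzero, mul_zero] at this
      refine SeparatingDual.eq_zero_of_forall_dual_eq_zero (R := ℝ) fun q => ?_
      have h1 := hge q
      have h2 := hge (-q)
      rw [neg_apply] at h2
      linarith
    rw [hd0, add_zero, show l = m by linarith] at hadd
    rw [← smul_right_injective E hm.ne' hadd] at hmS
    exact hbS hmS

theorem GeometricallyClosed.mem_of_semidentFree (h : GeometricallyClosed τ)
    (hI : τ.Mem (Icc (0 : ℝ) 1)) (hO : τ.Mem (Ioo (0 : ℝ) 1)) {E : Type} [NormedAddCommGroup E]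
    [NormedSpace ℝ E] [FiniteDimensional ℝ E] {S : Set E} (hS : Convex ℝ S)
    (hb : Bornology.IsBounded S) (hs : SemidentFree S) : τ.Mem S := by
  refine h.mem_of_forall_hull fun a ha => ?_
  have := (h.inv_smul_mem_of_semidentFree hI hO hS hb hs (Z := Set.univ) (x := Subtype.val)
    (fun i _ => i.2) (e := fun _ => 0) (M := 0) (fun _ => ⟨le_rfl, le_rfl⟩)
    (fun i hi => (hi trivial).elim) (a := a) (l := 1) ?_).2
  · simpa using this
  · exact RealFamily.mem_hull_of_affineMap ha
      ((LinearMap.prod LinearMap.id 0).toAffineMap + AffineMap.const ℝ _ ((0, 1, 0) : E × ℝ × ℝ))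
      (by simp) (fun i => by simp)

end Hulls

/-! ### Closed families of convex sets -/

section Classification

open Set

variable {τ : RealFamily}

theorem Submodule.exists_projection_along {E : Type} [AddCommGroup E] [Module ℝ E]
    (V : Submodule ℝ E) : ∃ P : E →ₗ[ℝ] E, (∀ v ∈ V, P v = 0) ∧ ∀ x, x - P x ∈ V := by
  obtain ⟨M, hM⟩ := V.exists_isCompl
  have hPV : ∀ v ∈ V, LinearMap.ofIsCompl hM 0 M.subtype v = 0 := fun v hv =>
    LinearMap.ofIsCompl_apply_left hM ⟨v, hv⟩
  have hPM : ∀ m ∈ M, LinearMap.ofIsCompl hM 0 M.subtype m = m := fun m hm =>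
    LinearMap.ofIsCompl_apply_right hM ⟨m, hm⟩
  refine ⟨LinearMap.ofIsCompl hM 0 M.subtype, hPV, fun x => ?_⟩
  obtain ⟨v, hv, m, hm, rfl⟩ : ∃ v ∈ V, ∃ m ∈ M, v + m = x := by
    rw [← Submodule.mem_sup, hM.sup_eq_top]; trivial
  rw [map_add, hPV v hv, hPM m hm, zero_add, add_sub_cancel_right]
  exact hv

/-- The sum of a bounded convex set and a subspace is the preimage of a bounded convex set under a
projection along the subspace. -/
theorem exists_projection_add_submodule {E : Type} [NormedAddCommGroup E] [NormedSpace ℝ E]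
    [FiniteDimensional ℝ E] {B : Set E} (hB : Bornology.IsBounded B) (hBc : Convex ℝ B)
    (V : Submodule ℝ E) :
    ∃ P : E →ₗ[ℝ] E, (∀ x, P (P x) = P x) ∧
      Bornology.IsBounded (P '' B) ∧ Convex ℝ (P '' B) ∧ B + (V : Set E) = P ⁻¹' (P '' B) := by
  obtain ⟨P, hP0, hPV⟩ := V.exists_projection_along
  refine ⟨P, fun x => ?_, P.toContinuousLinearMap.lipschitz.isBounded_image hB,
    hBc.linear_image P, ?_⟩
  · have := hP0 _ (hPV x)
    rw [map_sub, sub_eq_zero] at this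
    exact this.symm
  · ext x
    constructor
    · rintro ⟨b, hb, v, hv, rfl⟩
      exact ⟨b, hb, by simp [hP0 v hv]⟩
    · rintro ⟨b, hb, hbx⟩
      refine ⟨b, hb, x - b, ?_, add_sub_cancel b x⟩
      have := V.sub_mem (hPV x) (hPV b)
      rwa [hbx, sub_sub_sub_cancel_right] at this

theorem mem_boundedFamily_of_forall_add_mem {n : ℕ} {S K : Set (Fin n → ℝ)}
    {V : Submodule ℝ (Fin n → ℝ)} (hS : Convex ℝ S) (hK : IsCompact K)
    (hSK : S ⊆ K + (V : Set (Fin n → ℝ))) (hV : ∀ s ∈ S, ∀ v ∈ V, s + v ∈ S) :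
    S ∈ boundedFamily n := by
  obtain ⟨P, hP0, hPV⟩ := V.exists_projection_along
  refine ⟨P '' S, V, ?_, hS.linear_image P, ?_⟩
  · refine (hK.image P.continuous_of_finiteDimensional).isBounded.subset ?_
    rintro _ ⟨s, hs, rfl⟩
    obtain ⟨k, hk, v, hv, rfl⟩ := hSK hs
    exact ⟨k, hk, by simp [hP0 v hv]⟩
  · ext x
    constructor
    · intro hx
      exact ⟨P x, ⟨x, hx, rfl⟩, x - P x, hPV x, add_sub_cancel _ _⟩
    · rintro ⟨_, ⟨s, hs, rfl⟩, v, hv, rfl⟩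
      have := hV s hs _ (V.sub_mem hv (hPV s))
      convert this using 1
      change P s + v = _
      abel

namespace GeometricallyClosed

variable (h : GeometricallyClosed τ)
include h

/-! ### From generators to whole families -/

theorem compactFamily_subset (hI : τ.Mem (Icc (0 : ℝ) 1)) (n : ℕ) : compactFamily n ⊆ τ n := by
  rintro _ ⟨B, V, hB, hBc, rfl⟩
  exact (h.mem_compact_add_submodule hI hB hBc V).mem

/-- The bounded case is applied to the projection `P '' B`. As `P` is idempotent, this set lies in
`S` and `P` fixes its closure, so a semident of it would be one of `S`. -/
theorem semidentFreeFamily_subset (hI : τ.Mem (Icc (0 : ℝ) 1)) (hO : τ.Mem (Ioo (0 : ℝ) 1))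
    (n : ℕ) : semidentFreeFamily n ⊆ τ n := by
  rintro S ⟨⟨B, V, hB, hBc, hSBV⟩, hs⟩
  rw [forall_not_isSemident_iff] at hs
  obtain ⟨P, hPP, hPB, hPc, hpre⟩ := exists_projection_add_submodule hB hBc V
  have hPS : P '' B ⊆ S := by
    rintro _ ⟨b, hb, rfl⟩
    rw [hSBV, hpre]
    exact ⟨b, hb, (hPP b).symm⟩
  have hfix : closure (P '' B) ⊆ {x | P x = x} := by
    refine closure_minimal ?_ (isClosed_eq P.continuous_of_finiteDimensional continuous_id)
    rintro _ ⟨b, hb, rfl⟩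
    exact hPP b
  have hsem : SemidentFree (P '' B) := by
    intro s hsB t ht l hl
    have h1 := hs s (hPS hsB) t (closure_mono hPS ht) l hl
    rw [hSBV, hpre] at h1
    have h2 : P (l • s + (1 - l) • t) = l • s + (1 - l) • t := by
      rw [map_add, map_smul, map_smul, hfix ht, hfix (subset_closure hsB)]
    rwa [mem_preimage, h2] at h1
  rw [hSBV, hpre]
  exact ((h.mem_of_semidentFree hI hO hPc hPB hsem).preimage P.toAffineMap).mem

theorem boundedFamily_subset (hU : τ.Mem boxWedge) (n : ℕ) : boundedFamily n ⊆ τ n := by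
  rintro S ⟨B, V, hB, hBc, hSBV⟩
  obtain ⟨P, -, hPB, hPc, hpre⟩ := exists_projection_add_submodule hB hBc V
  rw [hSBV, hpre]
  exact ((h.mem_of_isBounded hU hPc hPB).preimage P.toAffineMap).mem

theorem rayFreeFamily_subset (hV : τ.Mem stripWedge) (n : ℕ) : rayFreeFamily n ⊆ τ n :=
  fun _ hS => (h.mem_of_rayFree hV hS.1 (not_hasRayIntersection_iff.1 hS.2)).mem

theorem convexFamily_subset (hW : τ.Mem halfPlaneWedge) (n : ℕ) : convexFamily n ⊆ τ n :=
  fun _ hS => (h.mem_of_convex hW hS).mem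

/-- For ray-free `S`, the closure is compact plus `V` and some `r + V` lies in `S`. If `S` is not of
the bounded type, a translation in `V` moves some `s` out of `S`; the plane through `s` spanned by
`r - s` and `v` then shows the strip with a defective edge. -/
theorem mem_stripWedge_of_not_bounded
    (hτ : ∀ (n : ℕ) (S : Set (Fin n → ℝ)), S ∈ τ n → Convex ℝ S) (hI : τ.Mem (Icc (0 : ℝ) 1))
    {n : ℕ} {S : Set (Fin n → ℝ)} (hS : S ∈ τ n) (hSb : S ∉ boundedFamily n) :
    τ.Mem stripWedge := by
  have hSc := hτ n S hS
  have hSm := h.mem_of_mem hS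
  by_cases hr : RayFree S
  swap
  · exact h.mem_stripWedge_of_halfPlaneWedge hI (h.mem_halfPlaneWedge_of_not_rayFree hSm hr)
  have hne : S.Nonempty := by
    rw [nonempty_iff_ne_empty]
    rintro rfl
    exact hSb ⟨∅, ⊥, Bornology.isBounded_empty, convex_empty, by simp⟩
  obtain ⟨K, V, hK, -, hKV, r, hrV⟩ := hr.exists_closure_eq hSc hne
  obtain ⟨s, hs, v, hv, hsv⟩ : ∃ s ∈ S, ∃ v ∈ V, s + v ∉ S := by
    by_contra! hcon
    exact hSb (mem_boundedFamily_of_forall_add_mem hSc hK (hKV ▸ subset_closure) hcon)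
  -- The point is the combination of `s` and `r + (p.2 / p.1) • v` with weights `1 - p.1` and `p.1`.
  have hgood : ∀ p : ℝ × ℝ, 0 < p.1 → p.1 ≤ 1 → s + p.1 • (r - s) + p.2 • v ∈ S := by
    intro p h0 h1
    have := hSc hs (hrV ((p.2 / p.1) • v) (V.smul_mem _ hv)) (sub_nonneg.2 h1) h0.le (by ring)
    convert this using 1
    rw [smul_add, smul_smul, mul_div_cancel₀ _ h0.ne']
    module
  refine h.mem_of_forall_notMem fun a ha => ?_
  simp only [stripWedge, mem_ofPred_eq, not_or, not_and, not_le] at ha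
  by_cases ha1 : 0 ≤ a.1 ∧ a.1 ≤ 1
  · have ha0 : a.1 = 0 := by
      by_contra h0
      exact absurd (ha.1 (lt_of_le_of_ne ha1.1 (Ne.symm h0))) (not_lt.2 ha1.2)
    have ha2 : a.2 ≠ 0 := fun h2 => ha.2 (Prod.ext ha0 h2)
    -- Scaling `v` by `(a.2)⁻¹` puts the missing point `s + v` at `a`.
    refine ⟨_, hSm.preimage_plane s (r - s) ((a.2)⁻¹ • v), ?_, ?_⟩
    · rintro p (⟨h0, h1⟩ | rfl)
      · have := hgood (p.1, p.2 * a.2⁻¹) h0 h1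
        simpa [mul_smul] using this
      · simpa using hs
    · simpa [ha0, ha2] using hsv
  · refine ⟨_, hI.preimage_functional (LinearMap.fst ℝ ℝ ℝ) 0, ?_, by simpa using ha1⟩
    rintro p (⟨h0, h1⟩ | rfl)
    · simpa using ⟨h0.le, h1⟩
    · simp

/-- In plane coordinates centred at `s`, the section `W` is full for `x > 0` near the origin, but
its edge `x = 0` stops before height `1 - l`. Intersecting the translates of `W` along the points of
that edge shrinks its nonnegative part to the origin. -/
theorem mem_boxWedge_of_semident
    (hτ : ∀ (n : ℕ) (S : Set (Fin n → ℝ)), S ∈ τ n → Convex ℝ S) (hI : τ.Mem (Icc (0 : ℝ) 1))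
    {n : ℕ} {S : Set (Fin n → ℝ)} (hS : S ∈ τ n) (hSs : ¬ SemidentFree S) :
    τ.Mem boxWedge := by
  have hSc := hτ n S hS
  simp only [SemidentFree, not_forall] at hSs
  obtain ⟨s, hs, t, ht, l, ⟨hl0, hl1⟩, hl⟩ := hSs
  obtain ⟨r, hrS, hcore⟩ := hSc.exists_combo_mem_of_mem_closure ⟨s, hs⟩
  set W : Set (ℝ × ℝ) := {p | s + p.1 • (r - s) + p.2 • (t - s) ∈ S} with hWdef
  have hW : τ.Mem W := (h.mem_of_mem hS).preimage_plane s (r - s) (t - s)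
  have hW0 : (0, 0) ∈ W := by simpa [hWdef] using hs
  have hWl : (0, 1 - l) ∉ W := by
    have e : s + (0 : ℝ) • (r - s) + (1 - l) • (t - s) = l • s + (1 - l) • t := by module
    simpa only [hWdef, mem_ofPred_eq, e] using hl
  have hWtri : ∀ x y : ℝ, 0 < x → 0 ≤ y → x + y ≤ 1 → (x, y) ∈ W := by
    intro x y hx hy hxy
    have hst : ∀ z : ℝ, 0 ≤ z → z ≤ 1 → (1 - z) • s + z • t ∈ closure S := fun z h0 h1 =>
      hSc.closure (subset_closure hs) ht (sub_nonneg.2 h1) h0 (by ring)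
    rcases eq_or_lt_of_le (show x ≤ 1 by linarith) with rfl | hx1
    · obtain rfl : y = 0 := by linarith
      simpa [hWdef] using hrS
    · have hx1' : 0 < 1 - x := by linarith
      have := hcore _ (hst (y / (1 - x)) (by positivity) ((div_le_one hx1').2 (by linarith)))
        x hx hx1.le
      change s + x • (r - s) + y • (t - s) ∈ S
      convert this using 1
      have e : (1 - x) * (1 - y / (1 - x)) = 1 - x - y := by field_simp
      rw [smul_add, smul_smul, smul_smul, e, mul_div_cancel₀ _ hx1'.ne']
      module
  have hWc : Convex ℝ W := hW.convex hτ
  have hWlt : ∀ y : ℝ, (0, y) ∈ W → y < 1 - l := by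
    intro y hy
    by_contra hly
    have hly := not_lt.1 hly
    have hy0 : 0 < y := by linarith
    have := hWc hW0 hy (a := 1 - (1 - l) / y) (b := (1 - l) / y)
      (by rw [sub_nonneg, div_le_one hy0]; exact hly) (by apply div_nonneg <;> linarith) (by ring)
    apply hWl
    convert this using 1
    ext <;> simp [hy0.ne']
  set U : Set (ℝ × ℝ) := ⋂ d : {d : ℝ // 0 ≤ d ∧ (0, d) ∈ W}, {p | ((0, (d : ℝ)) : ℝ × ℝ) +
    p.1 • ((1, 0) : ℝ × ℝ) + p.2 • ((0, 1) : ℝ × ℝ) ∈ W} with hUdef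
  have hU : τ.Mem U := h.mem_iInter fun d => hW.preimage_plane _ _ _
  have hUiff : ∀ x y : ℝ, (x, y) ∈ U ↔ ∀ d : ℝ, 0 ≤ d → (0, d) ∈ W → (x, d + y) ∈ W := by
    intro x y
    simp [hUdef]
  -- A positive `y` would allow climbing in steps of `y` from `(0, 0)` inside `W`, past the height
  -- `1 - l`.
  have hU0 : ∀ y : ℝ, (0, y) ∈ U → y ≤ 0 := by
    intro y hy
    by_contra hy0
    have hy0 := not_le.1 hy0
    rw [hUiff] at hy
    have hk : ∀ k : ℕ, (0, k * y) ∈ W := by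
      intro k
      induction k with
      | zero => simpa using hW0
      | succ k ih =>
        have := hy _ (by positivity) ih
        push_cast
        rwa [add_one_mul]
    obtain ⟨k, hk'⟩ := exists_nat_gt (1 / y)
    rw [div_lt_iff₀ hy0] at hk'
    linarith [hWlt _ (hk k)]
  -- As `d < 1 - l`, the square of side `l / 2` raised by `d` still satisfies `x + y ≤ 1`.
  set δ : ℝ := l / 2 with hδ
  have hδ0 : 0 < δ := by positivity
  convert h.mem_inter (h.mem_inter (hU.preimage_plane 0 ((δ, 0) : ℝ × ℝ) ((0, δ) : ℝ × ℝ))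
    (hI.preimage_functional (LinearMap.fst ℝ ℝ ℝ) 0))
    (hI.preimage_functional (LinearMap.snd ℝ ℝ ℝ) 0) using 1
  ext ⟨x, y⟩
  have e : (0 : ℝ × ℝ) + x • ((δ, 0) : ℝ × ℝ) + y • ((0, δ) : ℝ × ℝ) = (x * δ, y * δ) := by
    ext <;> simp
  simp only [boxWedge, mem_inter_iff, mem_ofPred_eq, e, LinearMap.fst_apply, LinearMap.snd_apply,
    add_zero, Set.mem_Icc, Prod.mk_eq_zero]
  constructor
  · rintro (⟨hx0, hx1, hy0, hy1⟩ | ⟨rfl, rfl⟩)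
    · refine ⟨⟨(hUiff _ _).2 fun d hd hdW => hWtri _ _ (by positivity) (by positivity) ?_,
        hx0.le, hx1⟩, hy0, hy1⟩
      have h1 := hWlt d hdW
      nlinarith
    · simp [hUiff]
  · rintro ⟨⟨hUxy, hx0, hx1⟩, hy0, hy1⟩
    rcases hx0.lt_or_eq with hx0 | rfl
    · exact Or.inl ⟨hx0, hx1, hy0, hy1⟩
    · refine Or.inr ⟨rfl, ?_⟩
      rw [zero_mul] at hUxy
      have := hU0 _ hUxy
      nlinarith

/-! ### Dichotomies along the chain of families -/

theorem subset_affine_or (hτ : ∀ (n : ℕ) (S : Set (Fin n → ℝ)), S ∈ τ n → Convex ℝ S) :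
    (∀ n, τ n ⊆ affineFamily n) ∨ τ.Mem (Icc (0 : ℝ) 1) := by
  rw [or_iff_not_imp_right]
  intro hI n S hS
  by_contra hSa
  exact hI (h.mem_Icc_of_not_affine hτ hS hSa)

theorem subset_compact_or (hτ : ∀ (n : ℕ) (S : Set (Fin n → ℝ)), S ∈ τ n → Convex ℝ S) :
    (∀ n, τ n ⊆ compactFamily n) ∨ τ.Mem (Ioo (0 : ℝ) 1) := by
  rw [or_iff_not_imp_right]
  intro hO n S hS
  by_contra hSa
  exact hO (h.mem_Ioo_of_not_compact hτ hS hSa)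

theorem subset_semidentFree_or (hτ : ∀ (n : ℕ) (S : Set (Fin n → ℝ)), S ∈ τ n → Convex ℝ S)
    (hI : τ.Mem (Icc (0 : ℝ) 1)) :
    (∀ n, τ n ⊆ semidentFreeFamily n) ∨ τ.Mem boxWedge := by
  rw [or_iff_not_imp_right]
  intro hU n S hS
  refine ⟨?_, forall_not_isSemident_iff.2 ?_⟩
  · by_contra hSb
    exact hU (h.mem_boxWedge_of_stripWedge hI (h.mem_stripWedge_of_not_bounded hτ hI hS hSb))
  · by_contra hs
    exact hU (h.mem_boxWedge_of_semident hτ hI hS hs)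

theorem subset_bounded_or (hτ : ∀ (n : ℕ) (S : Set (Fin n → ℝ)), S ∈ τ n → Convex ℝ S)
    (hI : τ.Mem (Icc (0 : ℝ) 1)) :
    (∀ n, τ n ⊆ boundedFamily n) ∨ τ.Mem stripWedge := by
  rw [or_iff_not_imp_right]
  intro hV n S hS
  by_contra hSb
  exact hV (h.mem_stripWedge_of_not_bounded hτ hI hS hSb)

theorem subset_rayFree_or (hτ : ∀ (n : ℕ) (S : Set (Fin n → ℝ)), S ∈ τ n → Convex ℝ S) :
    (∀ n, τ n ⊆ rayFreeFamily n) ∨ τ.Mem halfPlaneWedge := by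
  rw [or_iff_not_imp_right]
  intro hW n S hS
  refine ⟨hτ n S hS, not_hasRayIntersection_iff.2 ?_⟩
  by_contra hr
  exact hW (h.mem_halfPlaneWedge_of_not_rayFree (h.mem_of_mem hS) hr)

theorem isOneOfSix (hτ : ∀ (n : ℕ) (S : Set (Fin n → ℝ)), S ∈ τ n → Convex ℝ S) :
    IsOneOfSix τ := by
  rcases h.subset_affine_or hτ with hsub | hI
  · exact Or.inl (funext fun n => (hsub n).antisymm (h.affineFamily_subset n))
  refine Or.inr ?_
  rcases h.subset_compact_or hτ with hsub | hO
  · exact Or.inl (funext fun n => (hsub n).antisymm (h.compactFamily_subset hI n))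
  refine Or.inr ?_
  rcases h.subset_semidentFree_or hτ hI with hsub | hU
  · exact Or.inl (funext fun n => (hsub n).antisymm (h.semidentFreeFamily_subset hI hO n))
  refine Or.inr ?_
  rcases h.subset_bounded_or hτ hI with hsub | hV
  · exact Or.inl (funext fun n => (hsub n).antisymm (h.boundedFamily_subset hU n))
  refine Or.inr ?_
  rcases h.subset_rayFree_or hτ with hsub | hW
  · exact Or.inl (funext fun n => (hsub n).antisymm (h.rayFreeFamily_subset hV n))
  · exact Or.inr (funext fun n => Subset.antisymm (fun S hS => hτ n S hS)
      (h.convexFamily_subset hW n))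

end GeometricallyClosed

end Classification

/-! ### Families preserved by normalized linear maps -/

section Preservation

open Set Filter Topology

/-- The family of all convex sets preserved by the members of `F`. -/
def preservedFamily (F : Set ((ℕ → ℝ) →ₗ[ℝ] ℝ)) : RealFamily := fun _ =>
  {S | Convex ℝ S ∧ ∀ f ∈ F, Preserves f S}

theorem isFamilyPreservedByLinearMaps_iff {τ : RealFamily} :
    IsFamilyPreservedByLinearMaps τ ↔ ∃ F : Set ((ℕ → ℝ) →ₗ[ℝ] ℝ),
      (∀ f ∈ F, ∀ c : ℝ, f (fun _ => c) = c) ∧ τ = preservedFamily F := by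
  simp only [IsFamilyPreservedByLinearMaps, preservedFamily, funext_iff, Set.ext_iff,
    mem_ofPred_eq]

/-- Linearity handles the linear part of `g`, and the normalization on constant sequences its
constant term. -/
theorem map_affineMap_eq {f : (ℕ → ℝ) →ₗ[ℝ] ℝ} (hf : ∀ c : ℝ, f (fun _ => c) = c) {n : ℕ}
    (g : (Fin n → ℝ) →ᵃ[ℝ] ℝ) (x : ℕ → Fin n → ℝ) :
    f (fun i => g (x i)) = g (fun j => f (fun i => x i j)) := by
  have e : (fun i => g (x i)) =
      (fun _ => g 0) + ∑ j, g.linear (Pi.single j 1) • (fun i => x i j) := by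
    ext i
    rw [g.apply_eq_add_sum (x i)]
    simp [mul_comm]
  rw [e, map_add, hf, map_sum, g.apply_eq_add_sum (fun j => f (fun i => x i j))]
  simp [mul_comm]

theorem preservedFamily_convex (F : Set ((ℕ → ℝ) →ₗ[ℝ] ℝ)) :
    ∀ (n : ℕ) (S : Set (Fin n → ℝ)), S ∈ preservedFamily F n → Convex ℝ S :=
  fun _ _ hS => hS.1

variable {F : Set ((ℕ → ℝ) →ₗ[ℝ] ℝ)} (hF : ∀ f ∈ F, ∀ c : ℝ, f (fun _ => c) = c)
include hF

theorem geometricallyClosed_preservedFamily : GeometricallyClosed (preservedFamily F) where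
  empty_mem n := ⟨convex_empty, fun _ _ _ hx => hx 0⟩
  line_mem := ⟨convex_univ, fun _ _ _ _ => trivial⟩
  image_mem n m g S hS := by
    refine ⟨hS.1.affine_image g, fun f hf x hx => ?_⟩
    choose y hy hyx using hx
    refine ⟨_, hS.2 f hf y hy, ?_⟩
    ext j
    have := map_affineMap_eq (hF f hf)
      ((LinearMap.proj j : (Fin m → ℝ) →ₗ[ℝ] ℝ).toAffineMap.comp g) y
    simp only [AffineMap.comp_apply, LinearMap.coe_toAffineMap, LinearMap.proj_apply, hyx] at this
    exact this.symm
  preimage_mem n m g T hT := by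
    refine ⟨hT.1.affine_preimage g, fun f hf x hx => ?_⟩
    have := hT.2 f hf (fun i => g (x i)) hx
    have e : (fun j => f (fun i => g (x i) j)) = g (fun j => f (fun i => x i j)) := by
      ext j
      exact map_affineMap_eq (hF f hf)
        ((LinearMap.proj j : (Fin m → ℝ) →ₗ[ℝ] ℝ).toAffineMap.comp g) x
    rwa [e] at this
  sInter_mem n I hI := ⟨convex_sInter fun S hS => (hI hS).1, fun f hf x hx S hS =>
    (hI hS).2 f hf x fun i => hx i S hS⟩

/-- Preservation without coordinates: the value of `f` on a sequence in `E` is the point `a` that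
every functional sees as `f` of the values. -/
theorem preservedFamily_mem_iff {E : Type} [AddCommGroup E] [Module ℝ E] [FiniteDimensional ℝ E]
    {T : Set E} : (preservedFamily F).Mem T ↔ Convex ℝ T ∧ ∀ f ∈ F, ∀ x : ℕ → E, (∀ i, x i ∈ T) →
      ∀ a : E, (∀ p : E →ₗ[ℝ] ℝ, p a = f (fun i => p (x i))) → a ∈ T := by
  constructor
  · intro hT
    refine ⟨hT.convex (preservedFamily_convex F), fun f hf x hx a ha => ?_⟩
    let φ := (Module.finBasis ℝ E).equivFun
    have := (hT _ φ.symm.toLinearMap.toAffineMap).2 f hf (fun i => φ (x i)) fun i => by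
      simpa using hx i
    have e : (fun j => f (fun i => φ (x i) j)) = φ a := by
      ext j
      exact (ha (LinearMap.proj j ∘ₗ φ.toLinearMap)).symm
    rw [e] at this
    simpa using this
  · rintro ⟨hc, hT⟩ n g
    refine ⟨hc.affine_preimage g, fun f hf x hx => hT f hf _ hx _ fun p => ?_⟩
    exact (map_affineMap_eq (hF f hf) (p.toAffineMap.comp g) x).symm

theorem preservedFamily_mem_real_iff {T : Set ℝ} :
    (preservedFamily F).Mem T ↔ Convex ℝ T ∧ ∀ f ∈ F, ∀ x : ℕ → ℝ, (∀ i, x i ∈ T) → f x ∈ T := by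
  rw [preservedFamily_mem_iff hF]
  refine and_congr_right fun _ => forall₄_congr fun f _ x _ => ?_
  constructor
  · intro h
    refine h _ fun p => ?_
    have hp : ∀ y : ℝ, p y = p 1 * y := fun y => by
      rw [mul_comm, ← smul_eq_mul, ← map_smul, smul_eq_mul, mul_one]
    have e : (fun i => p (x i)) = p 1 • x := by
      ext i
      simp
    rw [e, map_smul, hp, smul_eq_mul]
  · intro h a ha
    have := ha LinearMap.id
    rw [LinearMap.id_apply] at this
    rw [this]
    exact h

theorem preservedFamily_mem_prod_iff {T : Set (ℝ × ℝ)} :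
    (preservedFamily F).Mem T ↔ Convex ℝ T ∧ ∀ f ∈ F, ∀ x : ℕ → ℝ × ℝ, (∀ i, x i ∈ T) →
      (f (fun i => (x i).1), f (fun i => (x i).2)) ∈ T := by
  rw [preservedFamily_mem_iff hF]
  refine and_congr_right fun _ => forall₄_congr fun f _ x _ => ?_
  constructor
  · intro h
    refine h _ fun p => ?_
    have hp : ∀ y : ℝ × ℝ, p y = p (1, 0) * y.1 + p (0, 1) * y.2 := fun y => by
      conv_lhs => rw [show y = y.1 • ((1, 0) : ℝ × ℝ) + y.2 • ((0, 1) : ℝ × ℝ) by ext <;> simp]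
      rw [map_add, map_smul, map_smul, smul_eq_mul, smul_eq_mul]
      ring
    have e : (fun i => p (x i)) =
        p (1, 0) • (fun i => (x i).1) + p (0, 1) • (fun i => (x i).2) := by
      ext i
      simpa using hp (x i)
    rw [e, map_add, map_smul, map_smul, hp, smul_eq_mul, smul_eq_mul]
  · intro h a ha
    have h1 := ha (LinearMap.fst ℝ ℝ ℝ)
    have h2 := ha (LinearMap.snd ℝ ℝ ℝ)
    simp only [LinearMap.fst_apply, LinearMap.snd_apply] at h1 h2
    rw [← Prod.mk.eta (p := a), h1, h2]
    exact h

end Preservation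

/-! ### Functionals on sequences -/

section Functionals

open Set Filter Topology

/-- The bounded real sequences. -/
def boundedSequences : Submodule ℝ (ℕ → ℝ) where
  carrier := {x | ∃ C : ℝ, ∀ i, |x i| ≤ C}
  add_mem' := by
    rintro x y ⟨C, hC⟩ ⟨D, hD⟩
    exact ⟨C + D, fun i => (abs_add_le _ _).trans (add_le_add (hC i) (hD i))⟩
  zero_mem' := ⟨0, by simp⟩
  smul_mem' := by
    rintro c x ⟨C, hC⟩
    refine ⟨|c| * C, fun i => ?_⟩
    simpa [abs_mul] using mul_le_mul_of_nonneg_left (hC i) (abs_nonneg c)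

theorem mem_boundedSequences_of_mem_Icc {x : ℕ → ℝ} (hx : ∀ i, x i ∈ Icc (0 : ℝ) 1) :
    x ∈ boundedSequences :=
  ⟨1, fun i => by rw [abs_of_nonneg (hx i).1]; exact (hx i).2⟩

theorem natCast_notMem_boundedSequences : (fun i : ℕ => (i : ℝ)) ∉ boundedSequences := by
  rintro ⟨C, hC⟩
  obtain ⟨n, hn⟩ := exists_nat_gt C
  exact absurd (hC n) (not_le.2 (hn.trans_le (le_abs_self _)))

/-- A functional on the bounded sequences extends to all sequences with a prescribed value at an
unbounded sequence. -/
theorem exists_extension_boundedSequences (g : boundedSequences →ₗ[ℝ] ℝ) {u : ℕ → ℝ}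
    (hu : u ∉ boundedSequences) (r : ℝ) :
    ∃ f : (ℕ → ℝ) →ₗ[ℝ] ℝ, (∀ x : boundedSequences, f x = g x) ∧ f u = r := by
  obtain ⟨f₀, hf₀⟩ := LinearMap.exists_extend g
  obtain ⟨k, hk, hkb⟩ := Submodule.exists_le_ker_of_notMem hu
  -- The correction `k` vanishes on bounded sequences but not at `u`.
  refine ⟨f₀ + ((r - f₀ u) / k u) • k, fun x => ?_, ?_⟩
  · have h1 : k x = 0 := hkb x.2
    have h2 : f₀ x = g x := LinearMap.congr_fun hf₀ x
    simp [h1, h2]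
  · simp [div_mul_cancel₀ _ hk]

/-- Bounded sequences converge along a nonprincipal ultrafilter; the limit is linear and extends
arbitrarily to all sequences. -/
theorem exists_tendsto_hyperfilter :
    ∃ f : (ℕ → ℝ) →ₗ[ℝ] ℝ, ∀ x ∈ boundedSequences, Tendsto x (hyperfilter ℕ) (𝓝 (f x)) := by
  have hlim : ∀ x : boundedSequences, ∃ a : ℝ, Tendsto (x : ℕ → ℝ) (hyperfilter ℕ) (𝓝 a) := by
    rintro ⟨x, C, hC⟩
    obtain ⟨a, -, ha⟩ := (isCompact_Icc (a := -C) (b := C)).ultrafilter_le_nhds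
      ((hyperfilter ℕ).map x) (tendsto_principal.2 (Eventually.of_forall fun i => abs_le.1 (hC i)))
    exact ⟨a, ha⟩
  choose L hL using hlim
  obtain ⟨f, hf⟩ := LinearMap.exists_extend (p := boundedSequences) (V' := ℝ)
    { toFun := L
      map_add' := fun x y => tendsto_nhds_unique (hL (x + y)) ((hL x).add (hL y))
      map_smul' := fun c x => tendsto_nhds_unique (hL (c • x)) ((hL x).const_smul c) }
  refine ⟨f, fun x hx => ?_⟩
  have : f x = L ⟨x, hx⟩ := LinearMap.congr_fun hf ⟨x, hx⟩
  rw [this]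
  exact hL ⟨x, hx⟩

theorem tendsto_hyperfilter_of_tendsto {x : ℕ → ℝ} {a : ℝ} (hx : Tendsto x atTop (𝓝 a)) :
    Tendsto x (hyperfilter ℕ) (𝓝 a) :=
  hx.mono_left Nat.hyperfilter_le_atTop

theorem const_mem_boundedSequences (c : ℝ) : (fun _ => c) ∈ boundedSequences :=
  ⟨|c|, fun _ => le_rfl⟩

theorem summable_mul_of_mem_boundedSequences {x : ℕ → ℝ} (hx : x ∈ boundedSequences) :
    Summable fun i => (1 : ℝ) / 2 / 2 ^ i * x i := by
  obtain ⟨C, hC⟩ := hx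
  refine Summable.of_norm_bounded ((summable_geometric_two' 1).mul_right C) fun i => ?_
  rw [norm_mul, Real.norm_of_nonneg (by positivity)]
  exact mul_le_mul_of_nonneg_left (hC i) (by positivity)

/-- The functional `x ↦ ∑ i, 2⁻¹⁻ⁱ x i` on bounded sequences. -/
noncomputable def dyadicMean : boundedSequences →ₗ[ℝ] ℝ where
  toFun x := ∑' i, (1 : ℝ) / 2 / 2 ^ i * (x : ℕ → ℝ) i
  map_add' x y := by
    rw [← (summable_mul_of_mem_boundedSequences x.2).tsum_add
      (summable_mul_of_mem_boundedSequences y.2)]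
    simp [mul_add]
  map_smul' c x := by
    rw [RingHom.id_apply, smul_eq_mul, ← tsum_mul_left]
    simp [mul_left_comm]

end Functionals

/-! ### The six families are preserved families -/

section Six

open Set Filter Topology

/-- The extrapolation `2 x₀ - x₁` preserves affine sets and leaves `[0, 1]`. -/
theorem isFamilyPreserved_affineFamily : IsFamilyPreservedByLinearMaps affineFamily := by
  rw [isFamilyPreservedByLinearMaps_iff]
  let f : (ℕ → ℝ) →ₗ[ℝ] ℝ := (2 : ℝ) • LinearMap.proj 0 - LinearMap.proj 1
  have hF : ∀ g ∈ ({f} : Set ((ℕ → ℝ) →ₗ[ℝ] ℝ)), ∀ c : ℝ, g (fun _ => c) = c := by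
    rintro _ rfl c
    simp [f]; ring
  have h := geometricallyClosed_preservedFamily hF
  refine ⟨{f}, hF, funext fun n => (h.affineFamily_subset n).antisymm ?_⟩
  refine (h.subset_affine_or (preservedFamily_convex _)).resolve_right (fun hI => ?_) n
  have := ((preservedFamily_mem_real_iff hF).1 hI).2 f rfl (Pi.single 0 1) fun i => by
    by_cases hi : i = 0 <;> simp [hi]
  norm_num [f] at this

theorem isFamilyPreserved_compactFamily : IsFamilyPreservedByLinearMaps compactFamily := by
  rw [isFamilyPreservedByLinearMaps_iff]
  obtain ⟨f, hf⟩ := exists_tendsto_hyperfilter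
  have hF : ∀ g ∈ ({f} : Set ((ℕ → ℝ) →ₗ[ℝ] ℝ)), ∀ c : ℝ, g (fun _ => c) = c := by
    rintro _ rfl c
    exact tendsto_nhds_unique (hf _ (const_mem_boundedSequences c)) tendsto_const_nhds
  have h := geometricallyClosed_preservedFamily hF
  have hI : (preservedFamily {f}).Mem (Icc (0 : ℝ) 1) := by
    refine (preservedFamily_mem_real_iff hF).2 ⟨convex_Icc 0 1, ?_⟩
    rintro _ rfl x hx
    exact isClosed_Icc.mem_of_tendsto (hf x (mem_boundedSequences_of_mem_Icc hx))
      (Eventually.of_forall hx)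
  refine ⟨{f}, hF, funext fun n => (h.compactFamily_subset hI n).antisymm ?_⟩
  refine (h.subset_compact_or (preservedFamily_convex _)).resolve_right (fun hO => ?_) n
  have hx : ∀ i : ℕ, (1 : ℝ) / ((i : ℝ) + 1) / 2 ∈ Ioo (0 : ℝ) 1 := fun i => by
    have h1 : (1 : ℝ) / ((i : ℝ) + 1) ≤ 1 := by
      rw [div_le_one (by positivity)]
      linarith [(Nat.cast_nonneg i : (0 : ℝ) ≤ i)]
    exact ⟨by positivity, by linarith⟩
  have h0 := tendsto_nhds_unique
    (hf _ (mem_boundedSequences_of_mem_Icc fun i => Ioo_subset_Icc_self (hx i)))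
    (tendsto_hyperfilter_of_tendsto ((tendsto_one_div_add_atTop_nhds_zero_nat (𝕜 := ℝ)).div_const 2))
  have := ((preservedFamily_mem_real_iff hF).1 hO).2 f rfl _ hx
  rw [h0] at this
  simp at this

/-- The functional averages `x₀` with an ultrafilter limit: the midpoint of a point of a set and a
point of its closure. -/
theorem isFamilyPreserved_semidentFreeFamily :
    IsFamilyPreservedByLinearMaps semidentFreeFamily := by
  rw [isFamilyPreservedByLinearMaps_iff]
  obtain ⟨g, hg⟩ := exists_tendsto_hyperfilter
  have hg01 : ∀ x : ℕ → ℝ, (∀ i, x i ∈ Icc (0 : ℝ) 1) → g x ∈ Icc (0 : ℝ) 1 := fun x hx =>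
    isClosed_Icc.mem_of_tendsto (hg x (mem_boundedSequences_of_mem_Icc hx))
      (Eventually.of_forall hx)
  set f : (ℕ → ℝ) →ₗ[ℝ] ℝ := (1 / 2 : ℝ) • (LinearMap.proj 0 + g) with hfdef
  have hfx : ∀ x, f x = (x 0 + g x) / 2 := fun x => by simp [hfdef]; ring
  have hF : ∀ g ∈ ({f} : Set ((ℕ → ℝ) →ₗ[ℝ] ℝ)), ∀ c : ℝ, g (fun _ => c) = c := by
    rintro _ rfl c
    rw [hfx, tendsto_nhds_unique (hg _ (const_mem_boundedSequences c)) tendsto_const_nhds]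
    ring
  have h := geometricallyClosed_preservedFamily hF
  have hI : (preservedFamily {f}).Mem (Icc (0 : ℝ) 1) := by
    refine (preservedFamily_mem_real_iff hF).2 ⟨convex_Icc 0 1, ?_⟩
    rintro _ rfl x hx
    have h1 := hx 0
    have h2 := hg01 x hx
    rw [hfx]
    exact ⟨by linarith [h1.1, h2.1], by linarith [h1.2, h2.2]⟩
  have hO : (preservedFamily {f}).Mem (Ioo (0 : ℝ) 1) := by
    refine (preservedFamily_mem_real_iff hF).2 ⟨convex_Ioo 0 1, ?_⟩
    rintro _ rfl x hx
    have h1 := hx 0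
    have h2 := hg01 x fun i => Ioo_subset_Icc_self (hx i)
    rw [hfx]
    exact ⟨by linarith [h1.1, h2.1], by linarith [h1.2, h2.2]⟩
  refine ⟨{f}, hF, funext fun n => (h.semidentFreeFamily_subset hI hO n).antisymm ?_⟩
  refine (h.subset_semidentFree_or (preservedFamily_convex _) hI).resolve_right (fun hU => ?_) n
  -- One term at the vertex and the others tending to `(0, 1)` have value `(0, 1/2)`, on the missing
  -- edge.
  let x : ℕ → ℝ × ℝ := fun i => if i = 0 then 0 else (1 / ((i : ℝ) + 1), 1)
  have hx1 : ∀ i, i ≠ 0 → x i = (1 / ((i : ℝ) + 1), 1) := fun i hi => by simp [x, hi]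
  have hfrac : ∀ i : ℕ, 0 < 1 / ((i : ℝ) + 1) ∧ 1 / ((i : ℝ) + 1) ≤ 1 := fun i => by
    refine ⟨by positivity, ?_⟩
    rw [div_le_one (by positivity)]
    linarith [(Nat.cast_nonneg i : (0 : ℝ) ≤ i)]
  have hxU : ∀ i, x i ∈ boxWedge := fun i => by
    by_cases hi : i = 0
    · exact Or.inr (by simp [x, hi])
    · rw [hx1 i hi]
      exact Or.inl ⟨(hfrac i).1, (hfrac i).2, zero_le_one, le_rfl⟩
  have hb : ∀ i, (x i).1 ∈ Icc (0 : ℝ) 1 ∧ (x i).2 ∈ Icc (0 : ℝ) 1 := fun i => by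
    rcases hxU i with hi | hi
    · exact ⟨⟨hi.1.le, hi.2.1⟩, hi.2.2⟩
    · simp [hi]
  have h1 : g (fun i => (x i).1) = 0 := by
    refine tendsto_nhds_unique (hg _ (mem_boundedSequences_of_mem_Icc fun i => (hb i).1))
      (tendsto_hyperfilter_of_tendsto
        ((tendsto_one_div_add_atTop_nhds_zero_nat (𝕜 := ℝ)).congr' ?_))
    filter_upwards [eventually_ne_atTop 0] with i hi
    rw [hx1 i hi]
  have h2 : g (fun i => (x i).2) = 1 := by
    refine tendsto_nhds_unique (hg _ (mem_boundedSequences_of_mem_Icc fun i => (hb i).2))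
      (tendsto_hyperfilter_of_tendsto (tendsto_const_nhds.congr' ?_))
    filter_upwards [eventually_ne_atTop 0] with i hi
    rw [hx1 i hi]
  have := ((preservedFamily_mem_prod_iff hF).1 hU).2 f rfl x hxU
  rw [hfx, hfx, h1, h2] at this
  norm_num [boxWedge, x] at this

/-- On bounded sequences the functional is `x₀`, so it preserves the bounded generators. Its value
`1` at the unbounded sequence `i` breaks the strip. -/
theorem isFamilyPreserved_boundedFamily : IsFamilyPreservedByLinearMaps boundedFamily := by
  rw [isFamilyPreservedByLinearMaps_iff]
  obtain ⟨f, hf, hf1⟩ := exists_extension_boundedSequences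
    (LinearMap.proj 0 ∘ₗ boundedSequences.subtype) natCast_notMem_boundedSequences 1
  have hf0 : ∀ x ∈ boundedSequences, f x = x 0 := fun x hx => hf ⟨x, hx⟩
  have hF : ∀ g ∈ ({f} : Set ((ℕ → ℝ) →ₗ[ℝ] ℝ)), ∀ c : ℝ, g (fun _ => c) = c := by
    rintro _ rfl c
    exact hf0 _ (const_mem_boundedSequences c)
  have h := geometricallyClosed_preservedFamily hF
  have hI : (preservedFamily {f}).Mem (Icc (0 : ℝ) 1) := by
    refine (preservedFamily_mem_real_iff hF).2 ⟨convex_Icc 0 1, ?_⟩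
    rintro _ rfl x hx
    rw [hf0 x (mem_boundedSequences_of_mem_Icc hx)]
    exact hx 0
  have hU : (preservedFamily {f}).Mem boxWedge := by
    refine (preservedFamily_mem_prod_iff hF).2 ⟨convex_boxWedge, ?_⟩
    rintro _ rfl x hx
    have hb : ∀ i, (x i).1 ∈ Icc (0 : ℝ) 1 ∧ (x i).2 ∈ Icc (0 : ℝ) 1 := fun i => by
      rcases hx i with hi | hi
      · exact ⟨⟨hi.1.le, hi.2.1⟩, hi.2.2⟩
      · simp [hi]
    rw [hf0 _ (mem_boundedSequences_of_mem_Icc fun i => (hb i).1),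
      hf0 _ (mem_boundedSequences_of_mem_Icc fun i => (hb i).2)]
    exact hx 0
  refine ⟨{f}, hF, funext fun n => (h.boundedFamily_subset hU n).antisymm ?_⟩
  refine (h.subset_bounded_or (preservedFamily_convex _) hI).resolve_right (fun hV => ?_) n
  let x : ℕ → ℝ × ℝ := fun i => (if i = 0 then 0 else 1, i)
  have := ((preservedFamily_mem_prod_iff hF).1 hV).2 f rfl x fun i => by
    by_cases hi : i = 0
    · exact Or.inr (by simp [x, hi])
    · exact Or.inl (by simp [x, hi])
  have h1 : f (fun i => (x i).1) = 0 := by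
    rw [hf0 _ (mem_boundedSequences_of_mem_Icc fun i => by by_cases hi : i = 0 <;> simp [x, hi])]
    simp [x]
  have h2 : f (fun i => (x i).2) = 1 := hf1
  rw [h1, h2] at this
  simp [stripWedge] at this

/-- On bounded sequences the functional is a mean with strictly positive weights. In the strip the
first coordinate is bounded, so its mean is positive unless all points are the vertex. The value
`-2` at the sequence `i` makes the mean of `i + 1` negative, which violates the half-plane. -/
theorem isFamilyPreserved_rayFreeFamily : IsFamilyPreservedByLinearMaps rayFreeFamily := by
  rw [isFamilyPreservedByLinearMaps_iff]
  obtain ⟨f, hf, hf1⟩ := exists_extension_boundedSequences dyadicMean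
    natCast_notMem_boundedSequences (-2)
  have hf0 : ∀ x ∈ boundedSequences, HasSum (fun i => (1 : ℝ) / 2 / 2 ^ i * x i) (f x) :=
    fun x hx => by
      rw [hf ⟨x, hx⟩]
      exact (summable_mul_of_mem_boundedSequences hx).hasSum
  have hF : ∀ g ∈ ({f} : Set ((ℕ → ℝ) →ₗ[ℝ] ℝ)), ∀ c : ℝ, g (fun _ => c) = c := by
    rintro _ rfl c
    refine (hf0 _ (const_mem_boundedSequences c)).unique ?_
    simpa using (hasSum_geometric_two' (1 : ℝ)).mul_right c
  have h := geometricallyClosed_preservedFamily hF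
  have hV : (preservedFamily {f}).Mem stripWedge := by
    refine (preservedFamily_mem_prod_iff hF).2 ⟨convex_stripWedge, ?_⟩
    rintro _ rfl x hx
    have hb : ∀ i, (x i).1 ∈ Icc (0 : ℝ) 1 := fun i => by
      rcases hx i with hi | hi
      · exact ⟨hi.1.le, hi.2⟩
      · simp [hi]
    by_cases hall : ∀ i, x i = 0
    · refine Or.inr ?_
      simp only [hall]
      exact Prod.ext (map_zero _) (map_zero _)
    · push Not at hall
      obtain ⟨j, hj⟩ := hall
      have hsum := hf0 _ (mem_boundedSequences_of_mem_Icc hb)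
      refine Or.inl ⟨?_, ?_⟩
      · have hj1 : 0 < (x j).1 := ((hx j).resolve_right hj).1
        have := hsum.summable.tsum_pos (fun i => mul_nonneg (by positivity) (hb i).1) j
          (by positivity)
        rwa [hsum.tsum_eq] at this
      · refine hasSum_le (fun i => ?_) hsum (hasSum_geometric_two' (1 : ℝ))
        exact mul_le_of_le_one_right (by positivity) (hb i).2
  refine ⟨{f}, hF, funext fun n => (h.rayFreeFamily_subset hV n).antisymm ?_⟩
  refine (h.subset_rayFree_or (preservedFamily_convex _)).resolve_right (fun hW => ?_) n
  have := ((preservedFamily_mem_prod_iff hF).1 hW).2 f rfl (fun i => ((i : ℝ) + 1, 0)) fun i =>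
    Or.inl (by positivity)
  have h1 : f (fun i => (i : ℝ) + 1) = -1 := by
    have e : (fun i : ℕ => (i : ℝ) + 1) = (fun i : ℕ => (i : ℝ)) + (fun _ => 1) := rfl
    rw [e, map_add, hf1, hF f rfl]
    norm_num
  simp only [h1] at this
  norm_num [halfPlaneWedge] at this

theorem isFamilyPreserved_convexFamily : IsFamilyPreservedByLinearMaps convexFamily :=
  ⟨∅, by simp, fun n S => by simp [convexFamily]⟩

theorem IsOneOfSix.isFamilyPreserved {τ : RealFamily} (hτ : IsOneOfSix τ) :
    IsFamilyPreservedByLinearMaps τ := by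
  rcases hτ with rfl | rfl | rfl | rfl | rfl | rfl
  · exact isFamilyPreserved_affineFamily
  · exact isFamilyPreserved_compactFamily
  · exact isFamilyPreserved_semidentFreeFamily
  · exact isFamilyPreserved_boundedFamily
  · exact isFamilyPreserved_rayFreeFamily
  · exact isFamilyPreserved_convexFamily

end Six

theorem theorem3p2 :
    (∀ τ : RealFamily, (∀ (n : ℕ) (S : Set (Fin n → ℝ)), S ∈ τ n → Convex ℝ S) →
      List.TFAE [ClosedUnderInfPP τ, GeometricallyClosed τ, IsOneOfSix τ,
        IsFamilyPreservedByLinearMaps τ]) ∧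
    (∀ τ : RealFamily, ClosedUnderInfPP τ ↔ GeometricallyClosed τ) := by
  refine ⟨fun τ hτ => ?_, fun τ => closedUnderInfPP_iff⟩
  tfae_have 1 ↔ 2 := closedUnderInfPP_iff
  tfae_have 2 → 3 := fun h => h.isOneOfSix hτ
  tfae_have 3 → 4 := fun h => h.isFamilyPreserved
  tfae_have 4 → 2 := by
    intro h
    obtain ⟨F, hF, rfl⟩ := isFamilyPreservedByLinearMaps_iff.1 h
    exact geometricallyClosed_preservedFamily hF
  tfae_finish
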